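/- Let $n\ge 1$ and let $\Omega\subset\mathbb{R}^n$ be open, bounded and simply connected, with Lipschitz boundary. Let $B_0=\prod_{k=1}^n[\tilde x_k,\tilde y_k]$ be a box such that $\tilde x_k<x_k<\tilde y_k$ for all $x\in\Omega$ and all $k$. Let $f=f(x,y,\mathbf z)$ be of class $C^1$ on $B_0\times\mathbb{R}\times\mathbb{R}^n$, with $\mathbf z\mapsto f(x,y,\mathbf z)$ convex for all $x\in\overline\Omega$, $y\in\mathbb{R}$. A function $\psi\in C^1(B_0)$ is called stationary if $x\mapsto f_{\mathbf z}(x,\psi(x),\nabla\psi(x))$ is differentiable on $B_0$ and $$\sum_{k=1}^n\frac{d}{dx_k}f_{z_k}(x,\psi(x),\nabla\psi(x))=f_y(x,\psi(x),\nabla\psi(x))\qquad\text{for all }x\in B_0 .$$ Let $y_0\in C^1(B_0)$ be stationary. Let $D_1\subset B_0\times\mathbb{R}$, $r>0$, and let $\mathcal F=\{\phi(\cdot,s): s\in L\}$, $L\subset(-r,r)$, be a family of stationary functions that contains $y_0$, where $\phi$ is of class $C^1$ on $B_0\times(-r,r)$, such that through each point $(x,y)\in D_1$ there passes exactly one function of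 $\mathcal F$. Write it as $y_3=\phi(\cdot,\Lambda(x,y))$ with $\Lambda(x,y)\in L$ and $\phi(x,\Lambda(x,y))=y$; assume that $\Lambda$ is continuous on $D_1$ and that $\frac{\partial\phi}{\partial s}(x,\Lambda(x,y))\ne0$ for $(x,y)\in D_1$. (No boundary condition on the functions of $\mathcal F$ is assumed; central families, all of whose members agree with $y_0$ on a face of $B_0$, are included.) Define $\theta(x,y)=\nabla y_3(x)$ on $D_1$, and assume that $D_1$ contains an open set containing the closure of $\{(x,y_0(x)):x\in\Omega\}$. Put $$F(y)=\int_\Omega f(x,y(x),\nabla y(x))\,dx,\qquad I(y)=\int_\Omega\Big(h(x,y(x))+\sum_{j=1}^nP_j(x,y(x))\,\frac{\partial y}{\partial x_j}(x)\Big)dx,$$ where $P_j(x,y)=f_{z_j}(x,y,\theta(x,y))$ and $h(x,y)=f(x,y,\theta(x,y))-\sum_jP_j(x,y)\,\theta_j(x,y)$, and $$\mathcal E(x,y,\mathbf w,\mathbf z)=f(x,y,\mathbf z)-f(x,y,\mathbf w)-\sum_{j=1}^nf_{z_j}(x,y,\mathbf w)(z_j-w_j).$$ Then there is $\delta>0$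 such that every $y\in C^1(\overline\Omega)$ with $y=y_0$ on $\partial\Omega$ and $\|y-y_0\|_\infty<\delta$ satisfies: $(x,y(x))\in D_1$ for all $x\in\overline\Omega$; $I(y)=I(y_0)$; $$F(y)-F(y_0)=\int_\Omega\mathcal E\big(x,y(x),\theta(x,y(x)),\nabla y(x)\big)\,dx;\qquad\text{and}\qquad F(y)\ge F(y_0).$$ -/

import Mathlib

open Set MeasureTheory

noncomputable section

/-- The space `ℝⁿ` with its Euclidean structure. -/
abbrev E (n : ℕ) : Type := EuclideanSpace ℝ (Fin n)

/-- `Ω` has a Lipschitz boundary: near each boundary point it is, up to a choice of the vertical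
unit direction `ν`, the strict epigraph of a Lipschitz function of the variables orthogonal
to `ν`. -/
def HasLipschitzBoundary {n : ℕ} (Ω : Set (E n)) : Prop :=
  ∀ p ∈ frontier Ω, ∃ ν : E n, ‖ν‖ = 1 ∧ ∃ (K : NNReal) (g : E n → ℝ),
    LipschitzWith K g ∧ (∀ (x : E n) (t : ℝ), g (x + t • ν) = g x) ∧
    ∃ ρ > 0, Ω ∩ Metric.ball p ρ = {x ∈ Metric.ball p ρ | g x < inner ℝ ν x}

/-- The closed box `∏ₖ [aₖ, bₖ]`. -/
def box {n : ℕ} (a b : Fin n → ℝ) : Set (E n) := {x | ∀ k, a k ≤ x k ∧ x k ≤ b k}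

/-- `y ∈ C¹(closure Ω)`: `y` is continuously differentiable in the open set `Ω`, and `y` and its
gradient extend continuously to the closure. -/
def IsC1Closure {n : ℕ} (Ω : Set (E n)) (y : E n → ℝ) : Prop :=
  ContDiffOn ℝ 1 y Ω ∧ ContinuousOn y (closure Ω) ∧
    ∃ G : E n → E n, ContinuousOn G (closure Ω) ∧ ∀ x ∈ Ω, G x = gradient y x

/-- The partial derivative `f_y (x, y, z)`. -/
def partialY {n : ℕ} (f : E n → ℝ → E n → ℝ) (x : E n) (y : ℝ) (z : E n) : ℝ :=
  deriv (fun s => f x s z) y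

/-- The vector `(f_{z_1}, …, f_{z_n}) (x, y, z)`. -/
def gradZ {n : ℕ} (f : E n → ℝ → E n → ℝ) (x : E n) (y : ℝ) (z : E n) : E n :=
  gradient (fun w => f x y w) z

/-- The divergence `∑ₖ ∂ pₖ / ∂ xₖ` of a vector field on a set `B`. -/
def divergenceWithin {n : ℕ} (p : E n → E n) (B : Set (E n)) (x : E n) : ℝ :=
  ∑ k : Fin n, (fderivWithin ℝ p B x (EuclideanSpace.single k 1)) k

/-- `ψ ∈ C¹(B)` is stationary for `f` on `B`: it satisfies the Euler-Lagrange equation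
`∑ₖ d/dxₖ f_{z_k}(x, ψ(x), ∇ψ(x)) = f_y(x, ψ(x), ∇ψ(x))` at every point of `B`
(in particular the function that is differentiated is differentiable). -/
def IsStationaryFor {n : ℕ} (f : E n → ℝ → E n → ℝ) (B : Set (E n)) (ψ : E n → ℝ) : Prop :=
  ContDiffOn ℝ 1 ψ B ∧
  DifferentiableOn ℝ (fun x => gradZ f x (ψ x) (gradientWithin ψ B x)) B ∧
  ∀ x ∈ B, divergenceWithin (fun t => gradZ f t (ψ t) (gradientWithin ψ B t)) B x =
    partialY f x (ψ x) (gradientWithin ψ B x)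

/-- The family `{φ(·, s) : s ∈ L}` of functions stationary for `f` on `B` simply covers
`D₁ ⊆ B × ℝ`: through each point `(x, y)` of `D₁` passes exactly one function of the family,
namely `φ(·, Λ(x, y))`. The family is regular in the sense of the implicit function theorem. -/
structure IsStationaryField {n : ℕ} (f : E n → ℝ → E n → ℝ) (B : Set (E n))
    (D₁ : Set (E n × ℝ)) (r : ℝ) (L : Set ℝ) (φ : E n → ℝ → ℝ) (Λ : E n → ℝ → ℝ) : Prop where
  base_mem : ∀ x y, (x, y) ∈ D₁ → x ∈ B
  param_subset : L ⊆ Ioo (-r) r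
  stationary : ∀ s ∈ L, IsStationaryFor f B (fun x => φ x s)
  param_mem : ∀ x y, (x, y) ∈ D₁ → Λ x y ∈ L
  passes : ∀ x y, (x, y) ∈ D₁ → φ x (Λ x y) = y
  unique : ∀ x y, (x, y) ∈ D₁ → ∀ s ∈ L, φ x s = y →
    EqOn (fun t => φ t s) (fun t => φ t (Λ x y)) B
  contDiffOn : ContDiffOn ℝ 1 (fun p : E n × ℝ => φ p.1 p.2) (B ×ˢ Ioo (-r) r)
  deriv_ne_zero : ∀ x y, (x, y) ∈ D₁ → deriv (φ x) (Λ x y) ≠ 0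
  param_continuousOn : ContinuousOn (fun p : E n × ℝ => Λ p.1 p.2) D₁

/-- The slope field `θ(x, y) = ∇y₃(x)`, where `y₃ = φ(·, Λ(x, y))` is the member of the family
that passes through `(x, y)`. -/
def slopeField {n : ℕ} (B : Set (E n)) (φ Λ : E n → ℝ → ℝ) (x : E n) (y : ℝ) : E n :=
  gradientWithin (fun t => φ t (Λ x y)) B x

/-- The functional `F(y) = ∫_Ω f(x, y(x), ∇y(x)) dx`. -/
def energy {n : ℕ} (f : E n → ℝ → E n → ℝ) (Ω : Set (E n)) (y : E n → ℝ) : ℝ :=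
  ∫ x in Ω, f x (y x) (gradient y x)

/-- The generalized Hilbert integral
`I(y) = ∫_Ω (h(x, y(x)) + ∑ⱼ Pⱼ(x, y(x)) ∂y/∂xⱼ(x)) dx` of a field `θ`, where
`Pⱼ(x, y) = f_{z_j}(x, y, θ(x, y))` and `h(x, y) = f(x, y, θ(x, y)) - ∑ⱼ Pⱼ(x, y) θⱼ(x, y)`. -/
def hilbertIntegral {n : ℕ} (f : E n → ℝ → E n → ℝ) (θ : E n → ℝ → E n) (Ω : Set (E n))
    (y : E n → ℝ) : ℝ :=
  ∫ x in Ω, ((f x (y x) (θ x (y x)) - inner ℝ (gradZ f x (y x) (θ x (y x))) (θ x (y x))) +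
    inner ℝ (gradZ f x (y x) (θ x (y x))) (gradient y x))

/-- The Weierstrass excess function
`f(x, y, z) - f(x, y, w) - ∑ⱼ f_{z_j}(x, y, w) (zⱼ - wⱼ)`. -/
def excess {n : ℕ} (f : E n → ℝ → E n → ℝ) (x : E n) (y : ℝ) (w z : E n) : ℝ :=
  f x y z - f x y w - inner ℝ (gradZ f x y w) (z - w)

end

/-!
# Minimality of a stationary function embedded in a field

The Hilbert integral is shown to depend only on the boundary values, and the Weierstrass formula
`F(y) - F(y₀) = ∫ excess` with `excess ≥ 0`, by convexity of the integrand in the gradient, then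
follows pointwise.

The members of the family are only `C¹`, so that the Hilbert integral cannot be treated as the
integral of a closed differential form: neither the slope field nor the coefficients of the form
need be differentiable. In the coordinates `(x, s)` given by the family the closedness is the
conservation law `∂/∂s f(x, φ, ∇φ) = div (φ_s f_z(x, φ, ∇φ))`, which is proved in a weak form
(`isWeakConservationLaw_of_stationary`). The increment of `∫ η f(x, φ, ∇φ)` between two members is
estimated from below by convexity in the gradient and the Euler-Lagrange equation of the first
member, tested with `η` times the difference of the members; exchanging the members gives the
estimate from above. All gradients of the difference cancel, so no derivative of `∇φ` in the
parameter is needed. The Euler-Lagrange equation is tested by means of the divergence theorem for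
vector fields that are merely differentiable (`integral_divergence_eq_zero`).

An admissible `y` is written as `y(x) = φ(x, σ(x))`, where `σ` is `C¹` with bounded gradient and
equals on the boundary the parameter `s₀` of `y₀`. The difference of the two Hilbert integrals is
the flux of the conservation law out of the region between the level `s₀` and the graph of `σ`, and
it vanishes (`integral_graph_sub_level_eq_zero`): the weak law is tested with smooth approximations
of the indicator of `{s < σ(x)}`. These have compact support in the domain where `σ > s₀`, hence no
regularity of the boundary is needed; the part where `σ < s₀` is symmetric, and on the level set
`{σ = s₀}` the gradient of `σ` vanishes almost everywhere, by Rademacher's theorem.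
-/

/-! ### The divergence theorem for compactly supported vector fields -/

/-- The integral of the divergence of a compactly supported vector field vanishes. The field is
only differentiable, and only the divergence itself, not each partial derivative, has to be
integrable. -/
theorem integral_divergence_eq_zero {n : ℕ} (hn : 0 < n) {v : E n → E n}
    {v' : E n → E n →L[ℝ] E n} (hv : ∀ x, HasFDerivAt v (v' x) x) (hc : HasCompactSupport v)
    (hi : Integrable (fun x => ∑ k : Fin n, (v' x (EuclideanSpace.single k 1)) k)) :
    ∫ x, ∑ k : Fin n, (v' x (EuclideanSpace.single k 1)) k = 0 := by
  obtain ⟨m, rfl⟩ : ∃ m, n = m + 1 := ⟨n - 1, by omega⟩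
  obtain ⟨R, hR⟩ := hc.isCompact.isBounded.subset_ball (0 : E (m + 1))
  have hout : ∀ (x : E (m + 1)) (i : Fin (m + 1)), R ≤ |x i| → x ∉ tsupport v := by
    intro x i hx hmem
    have h1 := hR hmem
    rw [mem_ball_zero_iff] at h1
    have h2 := PiLp.norm_apply_le x i
    rw [Real.norm_eq_abs] at h2
    linarith
  have hv'0 : ∀ x, x ∉ tsupport v → v' x = 0 := by
    intro x hx
    have h0 : v =ᶠ[nhds x] fun _ => 0 := notMem_tsupport_iff_eventuallyEq.mp hx
    exact (hv x).unique ((hasFDerivAt_const (0 : E (m + 1)) x).congr_of_eventuallyEq h0)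
  set d : E (m + 1) → ℝ := fun x => ∑ k, (v' x (EuclideanSpace.single k 1)) k with hd
  have hmp := PiLp.volume_preserving_toLp (Fin (m + 1))
  have hme : MeasurableEmbedding (WithLp.toLp 2 : (Fin (m + 1) → ℝ) → E (m + 1)) :=
    (MeasurableEquiv.toLp 2 (Fin (m + 1) → ℝ)).measurableEmbedding
  set R' := max R 0
  let w : (Fin (m + 1) → ℝ) → (Fin (m + 1) → ℝ) := fun x => WithLp.ofLp (v (WithLp.toLp 2 x))
  let e := PiLp.continuousLinearEquiv 2 ℝ (fun _ : Fin (m + 1) => ℝ)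
  let w' : (Fin (m + 1) → ℝ) → (Fin (m + 1) → ℝ) →L[ℝ] (Fin (m + 1) → ℝ) := fun x =>
    (e : E (m + 1) →L[ℝ] _).comp ((v' (WithLp.toLp 2 x)).comp (e.symm : _ →L[ℝ] E (m + 1)))
  have hw : ∀ x, HasFDerivAt w (w' x) x := by
    intro x
    have h1 : HasFDerivAt (fun x => e.symm x) (e.symm : _ →L[ℝ] E (m + 1)) x :=
      e.symm.hasFDerivAt
    have h2 := (hv (WithLp.toLp 2 x)).comp x h1
    exact (e.hasFDerivAt (x := v (WithLp.toLp 2 x))).comp x h2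
  have hdw : ∀ x : Fin (m + 1) → ℝ, ∑ i, w' x (Pi.single i 1) i = d (WithLp.toLp 2 x) := by
    intro x
    rfl
  have hiw : Integrable (fun x : Fin (m + 1) → ℝ => ∑ i, w' x (Pi.single i 1) i) := by
    simp_rw [hdw]
    exact (hmp.integrable_comp_emb hme).mpr hi
  have key := integral_divergence_of_hasFDerivAt_off_countable (a := fun _ => -R')
    (b := fun _ => R') (by intro i; simp [R']) w w' ∅ countable_empty
    (fun x _ => (hw x).continuousAt.continuousWithinAt) (fun x _ => hw x) hiw.integrableOn
  have hw0 : ∀ x i, R ≤ |x i| → w x = 0 := by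
    intro x i hx
    have := image_eq_zero_of_notMem_tsupport (hout (WithLp.toLp 2 x) i hx)
    simp [w, this]
  rw [← hmp.integral_comp hme]
  change ∫ x, d (WithLp.toLp 2 x) = 0
  simp_rw [← hdw]
  rw [setIntegral_eq_integral_of_forall_compl_eq_zero] at key
  · rw [key]
    refine Finset.sum_eq_zero fun i _ => ?_
    have hf : ∀ x, w (i.insertNth R' x) = 0 := fun x => hw0 _ i (by simp [R', le_abs])
    have hb : ∀ x, w (i.insertNth (-R') x) = 0 := fun x => hw0 _ i (by simp [R', le_abs])
    simp [hf, hb]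
  · intro x hx
    rw [hdw]
    have : ∃ i, R ≤ |x i| := by
      by_contra! hcon
      apply hx
      refine ⟨fun i => ?_, fun i => ?_⟩
      · have := (abs_lt.mp (hcon i)).1
        have := le_max_left R 0
        simp only [R']; linarith
      · have := (abs_lt.mp (hcon i)).2
        have := le_max_left R 0
        simp only [R']; linarith
    obtain ⟨i, hi⟩ := this
    simp [hd, hv'0 _ (hout (WithLp.toLp 2 x) i hi)]

theorem continuous_of_continuousOn_of_eq_zero_off {X : Type*} [TopologicalSpace X] {O : Set X}
    (hO : IsOpen O) {g : X → ℝ} {S : Set X} (hS : IsClosed S) (hSO : S ⊆ O)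
    (hg0 : ∀ x ∉ S, g x = 0) (hg : ContinuousOn g O) : Continuous g := by
  rw [continuous_iff_continuousAt]
  intro x
  by_cases hx : x ∈ S
  · exact hg.continuousAt (hO.mem_nhds (hSO hx))
  · have : g =ᶠ[nhds x] fun _ => 0 := by
      filter_upwards [hS.isOpen_compl.mem_nhds hx] with y hy using hg0 y hy
    exact continuousAt_const.congr this.symm

/-- Integration by parts against a test function `η`, for a vector field `p` that is only
differentiable but has a continuous divergence `q`. -/
theorem integral_fderiv_add_mul_eq_zero {n : ℕ} (hn : 0 < n) {O : Set (E n)} (hO : IsOpen O)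
    {p : E n → E n} {q : E n → ℝ} (hp : DifferentiableOn ℝ p O) (hq : ContinuousOn q O)
    (hdiv : ∀ x ∈ O, ∑ k : Fin n, (fderiv ℝ p x (EuclideanSpace.single k 1)) k = q x)
    {η : E n → ℝ} (hη : ContDiff ℝ 1 η) (hc : HasCompactSupport η) (hs : tsupport η ⊆ O) :
    Integrable (fun x => fderiv ℝ η x (p x) + η x * q x) ∧
      ∫ x, (fderiv ℝ η x (p x) + η x * q x) = 0 := by
  have h0 : ∀ x ∉ tsupport η, η x = 0 ∧ fderiv ℝ η x = 0 := fun x hx =>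
    ⟨image_eq_zero_of_notMem_tsupport hx,
      image_eq_zero_of_notMem_tsupport fun h => hx (tsupport_fderiv_subset ℝ h)⟩
  have hdη : Continuous (fderiv ℝ η) := hη.continuous_fderiv one_ne_zero
  have hcont : Continuous (fun x => fderiv ℝ η x (p x) + η x * q x) := by
    refine continuous_of_continuousOn_of_eq_zero_off hO (isClosed_tsupport η) hs ?_ ?_
    · intro x hx
      simp [h0 x hx]
    · exact (hdη.continuousOn.clm_apply hp.continuousOn).add (hη.continuous.continuousOn.mul hq)
  have hcs : HasCompactSupport (fun x => fderiv ℝ η x (p x) + η x * q x) :=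
    HasCompactSupport.intro hc (fun x hx => by simp [h0 x hx])
  have hint := hcont.integrable_of_hasCompactSupport (μ := volume) hcs
  refine ⟨hint, ?_⟩
  let v' : E n → E n →L[ℝ] E n := fun x =>
    η x • fderiv ℝ p x + (fderiv ℝ η x).smulRight (p x)
  have hv : ∀ x, HasFDerivAt (fun x => η x • p x) (v' x) x := by
    intro x
    have hηx := (hη.differentiable one_ne_zero x).hasFDerivAt
    by_cases hx : x ∈ tsupport η
    · exact hηx.smul ((hp x (hs hx)).differentiableAt (hO.mem_nhds (hs hx))).hasFDerivAt
    · have hv0 : v' x = 0 := by ext; simp [v', h0 x hx]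
      rw [hv0]
      refine (hasFDerivAt_const (0 : E n) x).congr_of_eventuallyEq ?_
      filter_upwards [(isClosed_tsupport η).isOpen_compl.mem_nhds hx] with y hy
      simp [h0 y hy]
  have hdivv : ∀ x, ∑ k : Fin n, (v' x (EuclideanSpace.single k 1)) k
      = fderiv ℝ η x (p x) + η x * q x := by
    intro x
    by_cases hx : x ∈ tsupport η
    · have hp' : fderiv ℝ η x (p x)
          = ∑ k, fderiv ℝ η x (EuclideanSpace.single k 1) * p x k := by
        conv_lhs => rw [← (EuclideanSpace.basisFun (Fin n) ℝ).sum_repr (p x)]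
        simp [map_sum, mul_comm]
      rw [hp', ← hdiv x (hs hx), Finset.mul_sum, ← Finset.sum_add_distrib]
      refine Finset.sum_congr rfl fun k _ => ?_
      simp [v', add_comm]
    · simp [v', h0 x hx]
  have := integral_divergence_eq_zero hn hv ?_ (by simpa only [hdivv] using hint)
  · simpa only [hdivv] using this
  · exact HasCompactSupport.intro hc (fun x hx => by simp [h0 x hx])

/-! ### Critical points on a level set -/

/-- Almost every point of a level set of a `C¹` function is critical: at the other points of the
level `c` the locally Lipschitz function `|σ - c|` is not differentiable, so that they form a null
set by Rademacher's theorem. -/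
theorem ae_fderiv_eq_zero_of_level {n : ℕ} {Ω : Set (E n)} (hΩ : IsOpen Ω) {σ : E n → ℝ}
    (hσ : ContDiffOn ℝ 1 σ Ω) (c : ℝ) :
    ∀ᵐ x : E n, x ∈ Ω → σ x = c → fderiv ℝ σ x = 0 := by
  have key : volume {x : E n | x ∈ Ω ∧ σ x = c ∧ fderiv ℝ σ x ≠ 0} = 0 := by
    refine measure_null_of_locally_null _ fun x hx => ?_
    obtain ⟨K, t, ht, hK⟩ := (hσ.contDiffAt (hΩ.mem_nhds hx.1)).exists_lipschitzOnWith
    have hlip : LipschitzOnWith K (fun z => |σ z - c|) (interior t) := by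
      refine LipschitzOnWith.of_dist_le_mul fun a ha b hb => ?_
      have h1 := hK.dist_le_mul a (interior_subset ha) b (interior_subset hb)
      refine le_trans ?_ h1
      rw [Real.dist_eq, Real.dist_eq]
      refine (abs_abs_sub_abs_le_abs_sub _ _).trans_eq ?_
      congr 1; ring
    have hae := hlip.ae_differentiableWithinAt_of_mem (μ := volume)
    refine ⟨interior t ∩ {x : E n | x ∈ Ω ∧ σ x = c ∧ fderiv ℝ σ x ≠ 0}, ?_, ?_⟩
    · exact Filter.inter_mem (mem_nhdsWithin_of_mem_nhds (interior_mem_nhds.mpr ht))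
        self_mem_nhdsWithin
    · refine measure_mono_null ?_ (ae_iff.mp hae)
      rintro z ⟨hzt, hzΩ, hzc, hz⟩ hdiff
      apply hz
      have hd : DifferentiableAt ℝ (fun z => |σ z - c|) z :=
        (hdiff hzt).differentiableAt (isOpen_interior.mem_nhds hzt)
      have hmin : IsLocalMin (fun z => |σ z - c|) z :=
        Filter.Eventually.of_forall fun y => by simp [hzc]
      have h0 := hd.hasFDerivAt
      rw [hmin.fderiv_eq_zero, hasFDerivAt_iff_isLittleO] at h0
      have h1 : HasFDerivAt σ (0 : E n →L[ℝ] ℝ) z := by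
        rw [hasFDerivAt_iff_isLittleO]
        refine Asymptotics.IsLittleO.congr' (f₁ := fun y => σ y - c)
          (g₁ := fun y => y - z) ?_ ?_ (Filter.EventuallyEq.rfl)
        · rw [← Asymptotics.isLittleO_abs_left]
          simpa [hzc] using h0
        · exact Filter.Eventually.of_forall fun y => by simp [hzc]
      exact h1.fderiv
  rw [ae_iff]
  refine measure_mono_null (fun x hx => ?_) key
  simpa using hx

/-! ### Weak conservation laws along the graph of a function -/

/-- The function `g` and the vector field `A`, depending on a parameter `s`, satisfy the
conservation law `∂g/∂s = div A` on `Ω` in the following weak sense: for nonnegative test functions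
`η`, the difference quotients of `s ↦ ∫ η g` approximate `-∫ ∇η · A` at a rate that depends only on
the `W^{1,1}` norm of `η`. -/
def IsWeakConservationLaw {n : ℕ} (Ω : Set (E n)) (J : Set ℝ) (g : E n → ℝ → ℝ)
    (A : E n → ℝ → E n) : Prop :=
  ∀ κ > 0, ∃ d > 0, ∀ s ∈ J, ∀ s' ∈ J, |s' - s| < d → ∀ η : E n → ℝ, ContDiff ℝ 1 η →
    HasCompactSupport η → tsupport η ⊆ Ω → (∀ x, 0 ≤ η x) →
      |(∫ x, η x * (g x s' - g x s)) + (s' - s) * ∫ x, fderiv ℝ η x (A x s)|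
        ≤ κ * |s' - s| * ∫ x, (η x + ‖fderiv ℝ η x‖)

theorem integrableOn_of_continuousOn_of_bounded {n : ℕ} {Ω : Set (E n)} (hΩ : IsOpen Ω)
    (hb : Bornology.IsBounded Ω) {w : E n → ℝ} (hw : ContinuousOn w Ω) {C : ℝ}
    (hC : ∀ x ∈ Ω, |w x| ≤ C) : IntegrableOn w Ω := by
  have : IsFiniteMeasure (volume.restrict Ω) := isFiniteMeasure_restrict.mpr hb.measure_lt_top.ne
  refine Integrable.of_bound (hw.aestronglyMeasurable hΩ.measurableSet) C ?_
  filter_upwards [ae_restrict_mem hΩ.measurableSet] with x hx using hC x hx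

/-- For `σ` with boundary values `s₀` and `s ≥ s₀`, the composite `χ(σ - s)`, extended by zero, is a
test function on `U` when `χ` vanishes up to `ε > 0`. -/
theorem contDiff_indicator_comp_sub {n : ℕ} {U : Set (E n)} (hU : IsOpen U)
    (hb : Bornology.IsBounded U) {s₀ s : ℝ} (hs : s₀ ≤ s) {σ : E n → ℝ}
    (hσ : ContinuousOn σ (closure U)) (hσ1 : ContDiffOn ℝ 1 σ U)
    (hσf : ∀ x ∈ frontier U, σ x = s₀) {χ : ℝ → ℝ} (hχ : ContDiff ℝ 1 χ) {ε : ℝ} (hε : 0 < ε)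
    (hχ0 : ∀ t ≤ ε, χ t = 0) :
    ContDiff ℝ 1 (U.indicator fun x => χ (σ x - s)) ∧
      HasCompactSupport (U.indicator fun x => χ (σ x - s)) ∧
      tsupport (U.indicator fun x => χ (σ x - s)) ⊆ U ∧
      (∀ x ∈ U, fderiv ℝ (U.indicator fun x => χ (σ x - s)) x
        = deriv χ (σ x - s) • fderiv ℝ σ x) ∧
      ∀ x ∉ U, fderiv ℝ (U.indicator fun x => χ (σ x - s)) x = 0 := by
  set ζ := U.indicator fun x => χ (σ x - s) with hζ
  set S : Set (E n) := closure U ∩ σ ⁻¹' Ici (s₀ + ε) with hS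
  have hSc : IsClosed S := hσ.preimage_isClosed_of_isClosed isClosed_closure isClosed_Ici
  have hSU : S ⊆ U := by
    rintro x ⟨hx, hxs⟩
    by_contra hxU
    have := hσf x (by rw [hU.frontier_eq]; exact ⟨hx, hxU⟩)
    simp only [mem_preimage, mem_Ici, this] at hxs
    linarith
  have hζ0 : ∀ x ∉ S, ζ x = 0 := by
    intro x hx
    by_cases hxU : x ∈ U
    · have : ¬ s₀ + ε ≤ σ x := fun h => hx ⟨subset_closure hxU, h⟩
      simp only [hζ, indicator_of_mem hxU]
      exact hχ0 _ (by linarith)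
    · simp [hζ, hxU]
  have hts : tsupport ζ ⊆ S := closure_minimal (fun x hx => by_contra fun h => hx (hζ0 x h)) hSc
  have hScomp : IsCompact S :=
    Metric.isCompact_of_isClosed_isBounded hSc (hb.closure.subset inter_subset_left)
  have heq : ∀ x ∈ U, ζ =ᶠ[nhds x] fun x => χ (σ x - s) := by
    intro x hx
    filter_upwards [hU.mem_nhds hx] with y hy
    simp [hζ, hy]
  refine ⟨?_, HasCompactSupport.intro hScomp hζ0, hts.trans hSU, ?_, ?_⟩
  · rw [contDiff_iff_contDiffAt]
    intro x
    by_cases hx : x ∈ U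
    · refine ContDiffAt.congr_of_eventuallyEq ?_ (heq x hx)
      exact hχ.contDiffAt.comp x ((hσ1.contDiffAt (hU.mem_nhds hx)).sub contDiffAt_const)
    · have hxS : x ∉ S := fun h => hx (hSU h)
      refine (contDiffAt_const (c := (0 : ℝ))).congr_of_eventuallyEq ?_
      filter_upwards [hSc.isOpen_compl.mem_nhds hxS] with y hy using hζ0 y hy
  · intro x hx
    rw [(heq x hx).fderiv_eq]
    have h1 : HasFDerivAt (fun x => σ x - s) (fderiv ℝ σ x) x :=
      (((hσ1.contDiffAt (hU.mem_nhds hx)).differentiableAt one_ne_zero).hasFDerivAt).sub_const s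
    exact ((hχ.differentiable one_ne_zero (σ x - s)).hasDerivAt.comp_hasFDerivAt x h1).fderiv
  · intro x hx
    exact image_eq_zero_of_notMem_tsupport fun h => hx (hSU (hts (tsupport_fderiv_subset ℝ h)))

/-- First-order Taylor expansion with a remainder that is uniform on the line. -/
theorem exists_uniform_taylor {χ : ℝ → ℝ} (hχ : ContDiff ℝ 1 χ)
    (hu : UniformContinuous (deriv χ)) {κ : ℝ} (hκ : 0 < κ) :
    ∃ d > 0, ∀ u h : ℝ, |h| < d → |deriv χ (u - h) - deriv χ u| ≤ κ ∧
      |χ (u - h) - χ u + h * deriv χ u| ≤ κ * |h| := by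
  obtain ⟨d, hd, hdu⟩ := Metric.uniformContinuous_iff.mp hu κ hκ
  have hclose : ∀ u v, |v - u| < d → |deriv χ v - deriv χ u| ≤ κ := fun u v h => by
    have := hdu (a := v) (b := u) (by rwa [Real.dist_eq])
    rw [Real.dist_eq] at this
    exact this.le
  refine ⟨d, hd, fun u h hh => ⟨hclose _ _ (by simpa using hh), ?_⟩⟩
  have hder : ∀ v, HasDerivAt (fun v => χ v - v * deriv χ u) (deriv χ v - deriv χ u) v := by
    intro v
    simpa using (hχ.differentiable one_ne_zero v).hasDerivAt.fun_sub
      ((hasDerivAt_id' v).mul_const (deriv χ u))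
  have := (convex_uIcc u (u - h)).norm_image_sub_le_of_norm_hasDerivWithin_le
    (f := fun v => χ v - v * deriv χ u) (C := κ)
    (fun v _ => (hder v).hasDerivWithinAt) (fun v hv => ?_) left_mem_uIcc right_mem_uIcc
  · simp only [Real.norm_eq_abs] at this
    have e1 : u - h - u = -h := by ring
    rw [e1, abs_neg] at this
    refine le_trans (le_of_eq ?_) this
    congr 1; ring
  · rw [Real.norm_eq_abs]
    refine hclose u v (lt_of_le_of_lt ?_ hh)
    have := abs_sub_left_of_mem_uIcc hv
    simpa using this

/-- The smeared form of the conservation law along the graph of `σ`: with `χ` in the place of the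
indicator of `(0, ∞)`, this is the fundamental theorem of calculus for
`s ↦ ∫ g(x, s) χ(σ(x) - s) dx`. -/
theorem integral_mul_comp_sub_eq {n : ℕ} {U : Set (E n)} (hU : IsOpen U)
    (hb : Bornology.IsBounded U) {s₀ s₁ : ℝ} (h01 : s₀ < s₁) {g : E n → ℝ → ℝ}
    {A : E n → ℝ → E n}
    (hg : ContinuousOn (fun p : E n × ℝ => g p.1 p.2) (closure U ×ˢ Icc s₀ s₁))
    (hA : ContinuousOn (fun p : E n × ℝ => A p.1 p.2) (closure U ×ˢ Icc s₀ s₁))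
    (hweak : IsWeakConservationLaw U (Icc s₀ s₁) g A) {σ : E n → ℝ}
    (hσ : ContinuousOn σ (closure U)) (hσ1 : ContDiffOn ℝ 1 σ U)
    {M : ℝ} (hM : ∀ x ∈ U, ‖fderiv ℝ σ x‖ ≤ M)
    (hσf : ∀ x ∈ frontier U, σ x = s₀) (hσs : ∀ x ∈ U, σ x ≤ s₁) {χ : ℝ → ℝ}
    (hχ : ContDiff ℝ 1 χ) {ε : ℝ} (hε : 0 < ε) (hχ0 : ∀ t ≤ ε, χ t = 0) (hχnn : ∀ t, 0 ≤ χ t)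
    (hχ1 : ∀ t, χ t ≤ 1) (hu : UniformContinuous (deriv χ)) {C : ℝ} (hC : ∀ t, |deriv χ t| ≤ C) :
    IntegrableOn
        (fun x => ∫ s in s₀..s₁, (g x s + fderiv ℝ σ x (A x s)) * deriv χ (σ x - s)) U ∧
      ∫ x in U, g x s₀ * χ (σ x - s₀) =
        ∫ x in U, ∫ s in s₀..s₁, (g x s + fderiv ℝ σ x (A x s)) * deriv χ (σ x - s) := by
  have hKc : IsCompact (closure U ×ˢ Icc s₀ s₁) := hb.isCompact_closure.prod isCompact_Icc
  obtain ⟨Cg, hCg⟩ := hKc.exists_bound_of_continuousOn hg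
  obtain ⟨CA, hCA⟩ := hKc.exists_bound_of_continuousOn hA
  have hCg' : ∀ x ∈ U, ∀ s ∈ Icc s₀ s₁, |g x s| ≤ Cg := fun x hx s hs =>
    hCg (x, s) ⟨subset_closure hx, hs⟩
  have hCA' : ∀ x ∈ U, ∀ s ∈ Icc s₀ s₁, ‖A x s‖ ≤ CA := fun x hx s hs =>
    hCA (x, s) ⟨subset_closure hx, hs⟩
  have hgs : ∀ s ∈ Icc s₀ s₁, ContinuousOn (fun x => g x s) U := fun s hs =>
    hg.comp (f := fun x => (x, s)) (by fun_prop) fun x hx => ⟨subset_closure hx, hs⟩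
  have hAs : ∀ s ∈ Icc s₀ s₁, ContinuousOn (fun x => A x s) U := fun s hs =>
    hA.comp (f := fun x => (x, s)) (by fun_prop) fun x hx => ⟨subset_closure hx, hs⟩
  have hσU : ContinuousOn σ U := hσ.mono subset_closure
  have hdσ : ContinuousOn (fderiv ℝ σ) U := hσ1.continuousOn_fderiv_of_isOpen hU le_rfl
  have hχc : Continuous χ := hχ.continuous
  have hdχ : Continuous (deriv χ) := hu.continuous
  have hχs : ∀ s, ContinuousOn (fun x => χ (σ x - s)) U := fun s =>
    hχc.comp_continuousOn (hσU.sub continuousOn_const)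
  have hdχs : ∀ s, ContinuousOn (fun x => deriv χ (σ x - s)) U := fun s =>
    hdχ.comp_continuousOn (hσU.sub continuousOn_const)
  have hDA : ∀ s ∈ Icc s₀ s₁, ContinuousOn (fun x => fderiv ℝ σ x (A x s)) U := fun s hs =>
    hdσ.clm_apply (hAs s hs)
  have hDAb : ∀ x ∈ U, ∀ s ∈ Icc s₀ s₁, |fderiv ℝ σ x (A x s)| ≤ M * CA := fun x hx s hs =>
    ((fderiv ℝ σ x).le_opNorm _).trans (mul_le_mul (hM x hx) (hCA' x hx s hs) (norm_nonneg _)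
      ((norm_nonneg _).trans (hM x hx)))
  have hχb : ∀ t, |χ t| ≤ 1 := fun t => by rw [abs_of_nonneg (hχnn t)]; exact hχ1 t
  have hC0 : 0 ≤ C := (abs_nonneg _).trans (hC 0)
  rcases U.eq_empty_or_nonempty with rfl | ⟨x₀, hx₀⟩
  · simp
  have hM0 : 0 ≤ M := (norm_nonneg _).trans (hM x₀ hx₀)
  have hCg0 : 0 ≤ Cg := (abs_nonneg _).trans (hCg' x₀ hx₀ s₀ ⟨le_rfl, h01.le⟩)
  have hCA0 : 0 ≤ CA := (norm_nonneg _).trans (hCA' x₀ hx₀ s₀ ⟨le_rfl, h01.le⟩)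
  have hfin : IsFiniteMeasure (volume.restrict U) :=
    isFiniteMeasure_restrict.mpr hb.measure_lt_top.ne
  set V : ℝ := volume.real U with hV
  have hV0 : 0 ≤ V := measureReal_nonneg
  -- a bounded integrand has an integral bounded by the volume
  have hnorm : ∀ {w : E n → ℝ} {c : ℝ}, (∀ x ∈ U, |w x| ≤ c) → |∫ x in U, w x| ≤ c * V :=
    fun {w c} h => by
      simpa only [Real.norm_eq_abs] using
        norm_setIntegral_le_of_norm_le_const (f := w) (C := c) (μ := volume) hb.measure_lt_top h
  let G : ℝ → ℝ := fun s => ∫ x in U, g x s * χ (σ x - s)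
  let D : ℝ → ℝ := fun s => ∫ x in U, (g x s + fderiv ℝ σ x (A x s)) * deriv χ (σ x - s)
  have hGderiv : ∀ s ∈ Icc s₀ s₁, HasDerivWithinAt G (-D s) (Icc s₀ s₁) s := by
    intro s hs
    rw [hasDerivWithinAt_iff_isLittleO, Asymptotics.isLittleO_iff]
    intro c hc
    set B : ℝ := (1 + C * M) * V + (Cg + M * CA) * V + 1 with hB
    have hBpos : 0 < B := by positivity
    set κ := c / B with hκdef
    have hκ : 0 < κ := div_pos hc hBpos
    obtain ⟨d₁, hd₁, hw⟩ := hweak κ hκ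
    obtain ⟨d₂, hd₂, ht⟩ := exists_uniform_taylor hχ hu hκ
    have hmem : Metric.ball s (min d₁ d₂) ∈ nhdsWithin s (Icc s₀ s₁) :=
      mem_nhdsWithin_of_mem_nhds (Metric.ball_mem_nhds s (lt_min hd₁ hd₂))
    filter_upwards [hmem, self_mem_nhdsWithin] with s' hs'd hs'
    rw [Metric.mem_ball, Real.dist_eq, lt_min_iff] at hs'd
    obtain ⟨hζ1, hζ2, hζ3, hζ4, hζ5⟩ := contDiff_indicator_comp_sub hU hb hs'.1 hσ hσ1 hσf hχ hε hχ0
    set ζ := U.indicator fun x => χ (σ x - s') with hζ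
    have hζU : ∀ x ∈ U, ζ x = χ (σ x - s') := fun x hx => by simp [hζ, hx]
    have hζU' : ∀ x ∉ U, ζ x = 0 := fun x hx => by simp [hζ, hx]
    have hmain := hw s hs s' hs' hs'd.1 ζ hζ1 hζ2 hζ3
      (fun x => indicator_nonneg (fun y _ => hχnn _) x)
    -- the three integrals over the whole space are integrals over `U`
    have e1 : ∫ x, ζ x * (g x s' - g x s) = ∫ x in U, χ (σ x - s') * (g x s' - g x s) := by
      rw [← setIntegral_eq_integral_of_forall_compl_eq_zero (s := U)
        (fun x hx => by simp [hζU' x hx])]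
      exact setIntegral_congr_fun hU.measurableSet fun x hx => by simp only [hζU x hx]
    have e2 : ∫ x, fderiv ℝ ζ x (A x s)
        = ∫ x in U, deriv χ (σ x - s') * fderiv ℝ σ x (A x s) := by
      rw [← setIntegral_eq_integral_of_forall_compl_eq_zero (s := U)
        (fun x hx => by simp [hζ5 x hx])]
      exact setIntegral_congr_fun hU.measurableSet fun x hx => by simp [hζ4 x hx]
    have e3 : ∫ x, (ζ x + ‖fderiv ℝ ζ x‖) ≤ (1 + C * M) * V := by
      rw [← setIntegral_eq_integral_of_forall_compl_eq_zero (s := U)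
        (fun x hx => by simp [hζ5 x hx, hζU' x hx])]
      refine (le_abs_self _).trans (hnorm fun x hx => ?_)
      have h1 : 0 ≤ ζ x := by rw [hζU x hx]; exact hχnn _
      rw [abs_of_nonneg (by positivity), hζU x hx, hζ4 x hx, norm_smul]
      exact add_le_add (hχ1 _) (mul_le_mul (hC _) (hM x hx) (norm_nonneg _) hC0)
    rw [e1, e2] at hmain
    -- the remaining two terms come from the Taylor expansion of `χ`
    have b3 : |∫ x in U, g x s * (χ (σ x - s') - χ (σ x - s) + (s' - s) * deriv χ (σ x - s))|
        ≤ Cg * (κ * |s' - s|) * V := by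
      refine hnorm fun x hx => ?_
      rw [abs_mul]
      have := (ht (σ x - s) (s' - s) hs'd.2).2
      rw [show σ x - s - (s' - s) = σ x - s' by ring] at this
      exact mul_le_mul (hCg' x hx s hs) this (abs_nonneg _) hCg0
    have b4 : |∫ x in U, (deriv χ (σ x - s') - deriv χ (σ x - s)) * fderiv ℝ σ x (A x s)|
        ≤ κ * (M * CA) * V := by
      refine hnorm fun x hx => ?_
      rw [abs_mul]
      have := (ht (σ x - s) (s' - s) hs'd.2).1
      rw [show σ x - s - (s' - s) = σ x - s' by ring] at this
      exact mul_le_mul this (hDAb x hx s hs) (abs_nonneg _) hκ.le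
    have i0 : ∀ u ∈ Icc s₀ s₁, ∀ v, IntegrableOn (fun x => g x u * χ (σ x - v)) U := by
      intro u hu v
      refine integrableOn_of_continuousOn_of_bounded hU hb ((hgs u hu).mul (hχs v)) (C := Cg * 1)
        fun x hx => ?_
      rw [abs_mul]
      exact mul_le_mul (hCg' x hx u hu) (hχb _) (abs_nonneg _) hCg0
    have i1 : ∀ v, IntegrableOn (fun x => g x s * deriv χ (σ x - v)) U := by
      intro v
      refine integrableOn_of_continuousOn_of_bounded hU hb ((hgs s hs).mul (hdχs v)) (C := Cg * C)
        fun x hx => ?_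
      rw [abs_mul]
      exact mul_le_mul (hCg' x hx s hs) (hC _) (abs_nonneg _) hCg0
    have i2 : ∀ v, IntegrableOn (fun x => deriv χ (σ x - v) * fderiv ℝ σ x (A x s)) U := by
      intro v
      refine integrableOn_of_continuousOn_of_bounded hU hb ((hdχs v).mul (hDA s hs))
        (C := C * (M * CA)) fun x hx => ?_
      rw [abs_mul]
      exact mul_le_mul (hC _) (hDAb x hx s hs) (abs_nonneg _) hC0
    have a1 : ∫ x in U, χ (σ x - s') * (g x s' - g x s)
        = G s' - ∫ x in U, g x s * χ (σ x - s') := by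
      rw [← integral_sub (i0 s' hs' s') (i0 s hs s')]
      congr 1; ext x; ring
    have a3 : ∫ x in U, g x s * (χ (σ x - s') - χ (σ x - s) + (s' - s) * deriv χ (σ x - s))
        = (∫ x in U, g x s * χ (σ x - s')) - G s
          + (s' - s) * ∫ x in U, g x s * deriv χ (σ x - s) := by
      rw [← integral_sub (i0 s hs s') (i0 s hs s), ← integral_const_mul, ← integral_add]
      · congr 1; ext x; ring
      · exact (i0 s hs s').sub (i0 s hs s)
      · exact (i1 s).const_mul _
    have a4 : ∫ x in U, (deriv χ (σ x - s') - deriv χ (σ x - s)) * fderiv ℝ σ x (A x s)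
        = (∫ x in U, deriv χ (σ x - s') * fderiv ℝ σ x (A x s))
          - ∫ x in U, deriv χ (σ x - s) * fderiv ℝ σ x (A x s) := by
      rw [← integral_sub (i2 s') (i2 s)]
      congr 1; ext x; ring
    have a5 : D s = (∫ x in U, g x s * deriv χ (σ x - s))
        + ∫ x in U, deriv χ (σ x - s) * fderiv ℝ σ x (A x s) := by
      simp only [D]
      rw [← integral_add (i1 s) (i2 s)]
      congr 1; ext x; ring
    have split : G s' - G s - (s' - s) • (-D s)
        = ((∫ x in U, χ (σ x - s') * (g x s' - g x s))
            + (s' - s) * ∫ x in U, deriv χ (σ x - s') * fderiv ℝ σ x (A x s))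
          + (∫ x in U, g x s * (χ (σ x - s') - χ (σ x - s) + (s' - s) * deriv χ (σ x - s)))
          - (s' - s) * ∫ x in U,
            (deriv χ (σ x - s') - deriv χ (σ x - s)) * fderiv ℝ σ x (A x s) := by
      rw [a1, a3, a4, a5, smul_eq_mul]; ring
    rw [split, Real.norm_eq_abs, Real.norm_eq_abs]
    have hκB : κ * B = c := div_mul_cancel₀ c hBpos.ne'
    have habs : 0 ≤ |s' - s| := abs_nonneg _
    refine (abs_sub _ _).trans ((add_le_add (abs_add_le _ _) le_rfl).trans ?_)
    rw [abs_mul (s' - s) (∫ x in U, _)]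
    have m1 := hmain.trans (mul_le_mul_of_nonneg_left e3 (by positivity : 0 ≤ κ * |s' - s|))
    have m4 := mul_le_mul_of_nonneg_left b4 habs
    have : κ * |s' - s| * ((1 + C * M) * V) + Cg * (κ * |s' - s|) * V
        + |s' - s| * (κ * (M * CA) * V) = (κ * B - κ) * |s' - s| := by
      rw [hB]; ring
    nlinarith [mul_nonneg hκ.le habs]
  -- joint integrability of the derivative
  have hint : Integrable (Function.uncurry fun s x =>
      (g x s + fderiv ℝ σ x (A x s)) * deriv χ (σ x - s))
      ((volume.restrict (Icc s₀ s₁)).prod (volume.restrict U)) := by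
    have hsw : MapsTo (fun p : ℝ × E n => (p.2, p.1)) (Icc s₀ s₁ ×ˢ U) (closure U ×ˢ Icc s₀ s₁) :=
      fun p hp => ⟨subset_closure hp.2, hp.1⟩
    have hsnd : MapsTo (Prod.snd : ℝ × E n → E n) (Icc s₀ s₁ ×ˢ U) U := fun p hp => hp.2
    have hcont : ContinuousOn (Function.uncurry fun s x =>
        (g x s + fderiv ℝ σ x (A x s)) * deriv χ (σ x - s)) (Icc s₀ s₁ ×ˢ U) := by
      refine ContinuousOn.mul (ContinuousOn.add ?_ (ContinuousOn.clm_apply ?_ ?_)) ?_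
      · exact hg.comp (by fun_prop) hsw
      · exact hdσ.comp continuousOn_snd hsnd
      · exact hA.comp (by fun_prop) hsw
      · exact hdχ.comp_continuousOn ((hσU.comp continuousOn_snd hsnd).sub continuousOn_fst)
    refine Integrable.of_bound ?_ ((Cg + M * CA) * C) ?_
    · rw [Measure.prod_restrict]
      exact hcont.aestronglyMeasurable (measurableSet_Icc.prod hU.measurableSet)
    · rw [Measure.prod_restrict]
      filter_upwards [ae_restrict_mem (measurableSet_Icc.prod hU.measurableSet)] with p hp
      rw [Real.norm_eq_abs, Function.uncurry_def, abs_mul]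
      exact mul_le_mul ((abs_add_le _ _).trans (add_le_add (hCg' _ hp.2 _ hp.1)
        (hDAb _ hp.2 _ hp.1))) (hC _) (abs_nonneg _) (by positivity)
  have hftc : ∫ s in s₀..s₁, -D s = G s₁ - G s₀ := by
    refine intervalIntegral.integral_eq_sub_of_hasDeriv_right ?_ ?_ ?_
    · rw [uIcc_of_le h01.le]
      exact fun s hs => (hGderiv s hs).continuousWithinAt
    · rw [min_eq_left h01.le, max_eq_right h01.le]
      intro s hs
      exact ((hGderiv s (Ioo_subset_Icc_self hs)).hasDerivAt
        (Icc_mem_nhds hs.1 hs.2)).hasDerivWithinAt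
    · rw [intervalIntegrable_iff_integrableOn_Icc_of_le h01.le]
      exact hint.integral_prod_left.neg
  have hG1 : G s₁ = 0 := by
    refine setIntegral_eq_zero_of_forall_eq_zero fun x hx => ?_
    have := hσs x hx
    rw [hχ0 _ (by linarith), mul_zero]
  rw [hG1, intervalIntegral.integral_neg] at hftc
  have : G s₀ = ∫ s in s₀..s₁, D s := by linarith
  have hint' : Integrable (Function.uncurry fun s x =>
      (g x s + fderiv ℝ σ x (A x s)) * deriv χ (σ x - s))
      ((volume.restrict (Ioc s₀ s₁)).prod (volume.restrict U)) :=
    hint.mono_measure (Measure.prod_mono (Measure.restrict_mono_set _ Ioc_subset_Icc_self) le_rfl)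
  refine ⟨?_, ?_⟩
  · simp_rw [intervalIntegral.integral_of_le h01.le]
    exact hint'.integral_prod_right
  · rw [show ∫ x in U, g x s₀ * χ (σ x - s₀) = G s₀ from rfl, this]
    refine intervalIntegral_integral_swap ?_
    rw [uIoc_of_le h01.le]
    exact hint'

/-- A smooth approximation of the indicator of `(0, ∞)`: a step that rises between `ε` and `2 ε`. -/
theorem exists_smooth_step {ε : ℝ} (hε : 0 < ε) :
    ∃ χ : ℝ → ℝ, ContDiff ℝ 1 χ ∧ (∀ t ≤ ε, χ t = 0) ∧ (∀ t, 2 * ε ≤ t → χ t = 1) ∧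
      (∀ t, 0 ≤ χ t) ∧ (∀ t, χ t ≤ 1) ∧ (∀ t, 0 ≤ deriv χ t) ∧
      (∀ t, t ∉ Icc ε (2 * ε) → deriv χ t = 0) ∧ UniformContinuous (deriv χ) ∧
      ∃ C, ∀ t, |deriv χ t| ≤ C := by
  let χ : ℝ → ℝ := fun t => Real.smoothTransition (t / ε - 1)
  have h0 : ∀ t ≤ ε, χ t = 0 := fun t ht =>
    Real.smoothTransition.zero_of_nonpos (by rw [sub_nonpos, div_le_one hε]; exact ht)
  have h1 : ∀ t, 2 * ε ≤ t → χ t = 1 := fun t ht =>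
    Real.smoothTransition.one_of_one_le (by rw [le_sub_iff_add_le, le_div_iff₀ hε]; linarith)
  have hχ : ContDiff ℝ 1 χ := by
    have : ContDiff ℝ 1 Real.smoothTransition := Real.smoothTransition.contDiff (n := 1)
    exact this.comp ((contDiff_id.div_const ε).sub contDiff_const)
  have hmono : Monotone χ := fun a b hab => Real.smoothTransition.monotone (by gcongr)
  have hd0 : ∀ t, t ∉ Icc ε (2 * ε) → deriv χ t = 0 := by
    intro t ht
    rw [mem_Icc, not_and_or, not_le, not_le] at ht
    rcases ht with ht | ht
    · have : χ =ᶠ[nhds t] fun _ => 0 := by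
        filter_upwards [Iio_mem_nhds ht] with y hy using h0 y (le_of_lt hy)
      rw [this.deriv_eq, deriv_const]
    · have : χ =ᶠ[nhds t] fun _ => 1 := by
        filter_upwards [Ioi_mem_nhds ht] with y hy using h1 y (le_of_lt hy)
      rw [this.deriv_eq, deriv_const]
  have hcs : HasCompactSupport (deriv χ) := HasCompactSupport.intro isCompact_Icc hd0
  have hdc : Continuous (deriv χ) := hχ.continuous_deriv_one
  obtain ⟨C, hC⟩ := hdc.bounded_above_of_compact_support hcs
  exact ⟨χ, hχ, h0, h1, fun t => Real.smoothTransition.nonneg _,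
    fun t => Real.smoothTransition.le_one _, fun t => hmono.deriv_nonneg, hd0,
    hdc.uniformContinuous_of_tendsto_cocompact hcs.is_zero_at_infty, C, hC⟩

/-- A weak conservation law `∂g/∂s = div A` integrated over the region between the level `s₀` and
the graph of a function `σ > s₀` on `U` with boundary values `s₀`: the flux through the graph and
the flux through the level agree. -/
theorem integral_graph_sub_level_eq_zero_of_lt {n : ℕ} {U : Set (E n)} (hU : IsOpen U)
    (hb : Bornology.IsBounded U) {s₀ s₁ : ℝ} (h01 : s₀ < s₁) {g : E n → ℝ → ℝ}
    {A : E n → ℝ → E n}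
    (hg : ContinuousOn (fun p : E n × ℝ => g p.1 p.2) (closure U ×ˢ Icc s₀ s₁))
    (hA : ContinuousOn (fun p : E n × ℝ => A p.1 p.2) (closure U ×ˢ Icc s₀ s₁))
    (hweak : IsWeakConservationLaw U (Icc s₀ s₁) g A) {σ : E n → ℝ}
    (hσ : ContinuousOn σ (closure U)) (hσ1 : ContDiffOn ℝ 1 σ U)
    {M : ℝ} (hM : ∀ x ∈ U, ‖fderiv ℝ σ x‖ ≤ M)
    (hσf : ∀ x ∈ frontier U, σ x = s₀) (hσs : ∀ x ∈ U, σ x ∈ Ioc s₀ s₁) :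
    ∫ x in U, (g x (σ x) - g x s₀ + fderiv ℝ σ x (A x (σ x))) = 0 := by
  rcases U.eq_empty_or_nonempty with rfl | ⟨x₀, hx₀⟩
  · simp
  have hM0 : 0 ≤ M := (norm_nonneg _).trans (hM x₀ hx₀)
  have hKc : IsCompact (closure U ×ˢ Icc s₀ s₁) := hb.isCompact_closure.prod isCompact_Icc
  obtain ⟨Cg, hCg⟩ := hKc.exists_bound_of_continuousOn hg
  obtain ⟨CA, hCA⟩ := hKc.exists_bound_of_continuousOn hA
  have hs₀ : s₀ ∈ Icc s₀ s₁ := ⟨le_rfl, h01.le⟩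
  have hσI : ∀ x ∈ U, σ x ∈ Icc s₀ s₁ := fun x hx => Ioc_subset_Icc_self (hσs x hx)
  have hσU : ContinuousOn σ U := hσ.mono subset_closure
  have hdσ : ContinuousOn (fderiv ℝ σ) U := hσ1.continuousOn_fderiv_of_isOpen hU le_rfl
  have hfin : IsFiniteMeasure (volume.restrict U) :=
    isFiniteMeasure_restrict.mpr hb.measure_lt_top.ne
  set w : E n → ℝ := fun x => g x (σ x) - g x s₀ + fderiv ℝ σ x (A x (σ x)) with hw
  have hpair : ContinuousOn (fun x => (x, σ x)) U := continuousOn_id.prodMk hσU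
  have hwc : ContinuousOn w U := by
    refine (ContinuousOn.sub ?_ ?_).add (hdσ.clm_apply ?_)
    · exact hg.comp hpair fun x hx => ⟨subset_closure hx, hσI x hx⟩
    · exact hg.comp (f := fun x => (x, s₀)) (by fun_prop) fun x hx => ⟨subset_closure hx, hs₀⟩
    · exact hA.comp hpair fun x hx => ⟨subset_closure hx, hσI x hx⟩
  have hDAb : ∀ x ∈ U, ∀ s ∈ Icc s₀ s₁, |fderiv ℝ σ x (A x s)| ≤ M * CA := fun x hx s hs =>
    ((fderiv ℝ σ x).le_opNorm _).trans (mul_le_mul (hM x hx) (hCA (x, s) ⟨subset_closure hx, hs⟩)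
      (norm_nonneg _) hM0)
  have hwb : ∀ x ∈ U, |w x| ≤ Cg + Cg + M * CA := by
    intro x hx
    refine (abs_add_le _ _).trans (add_le_add ((abs_sub _ _).trans (add_le_add ?_ ?_)) ?_)
    · exact hCg (x, σ x) ⟨subset_closure hx, hσI x hx⟩
    · exact hCg (x, s₀) ⟨subset_closure hx, hs₀⟩
    · exact hDAb x hx _ (hσI x hx)
  set V : ℝ := volume.real U with hV
  have hV0 : 0 ≤ V := measureReal_nonneg
  choose! χ hχ hχ0 hχ1 hχnn hχle hχ'nn hχ'0 hχ'u Cχ hCχ using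
    fun (ε : ℝ) (hε : 0 < ε) => exists_smooth_step hε
  have he : ∀ m : ℕ, (0 : ℝ) < 1 / ((m : ℝ) + 1) := fun m => Nat.one_div_pos_of_nat
  have hlim := tendsto_one_div_add_atTop_nhds_zero_nat (𝕜 := ℝ)
  have hpt : ∀ x ∈ U, Filter.Tendsto
      (fun m : ℕ => χ (1 / ((m : ℝ) + 1)) (σ x - s₀)) Filter.atTop (nhds 1) := by
    intro x hx
    refine tendsto_const_nhds.congr' ?_
    have hpos : 0 < (σ x - s₀) / 2 := by linarith [(hσs x hx).1]
    filter_upwards [hlim.eventually (Iio_mem_nhds hpos)] with m hm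
    exact (hχ1 _ (he m) _ (by linarith)).symm
  have hχσ : ∀ m : ℕ, ContinuousOn (fun x => χ (1 / ((m : ℝ) + 1)) (σ x - s₀)) U := fun m =>
    (hχ _ (he m)).continuous.comp_continuousOn (hσU.sub continuousOn_const)
  have hconv : Filter.Tendsto
      (fun m : ℕ => ∫ x in U, χ (1 / ((m : ℝ) + 1)) (σ x - s₀) * w x)
      Filter.atTop (nhds (∫ x in U, w x)) := by
    refine tendsto_integral_of_dominated_convergence (fun _ => Cg + Cg + M * CA)
      (fun m => ((hχσ m).mul hwc).aestronglyMeasurable hU.measurableSet)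
      (integrable_const _) (fun m => ?_) ?_
    · filter_upwards [ae_restrict_mem hU.measurableSet] with x hx
      rw [Real.norm_eq_abs, abs_mul, abs_of_nonneg (hχnn _ (he m) _)]
      exact (mul_le_of_le_one_left (abs_nonneg _) (hχle _ (he m) _)).trans (hwb x hx)
    · filter_upwards [ae_restrict_mem hU.measurableSet] with x hx
      simpa using (hpt x hx).mul_const (w x)
  -- the smeared identity shows that the approximating integrals are small
  have hsmall : ∀ κ > 0, |∫ x in U, w x| ≤ κ * (1 + M) * V := by
    intro κ hκ
    obtain ⟨d₁, hd₁, hug⟩ := Metric.uniformContinuousOn_iff.mp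
      (hKc.uniformContinuousOn_of_continuous hg) κ hκ
    obtain ⟨d₂, hd₂, huA⟩ := Metric.uniformContinuousOn_iff.mp
      (hKc.uniformContinuousOn_of_continuous hA) κ hκ
    refine le_of_tendsto hconv.abs ?_
    have hdpos : 0 < min d₁ d₂ / 2 := half_pos (lt_min hd₁ hd₂)
    filter_upwards [hlim.eventually (Iio_mem_nhds hdpos)] with m hm
    set ε : ℝ := 1 / ((m : ℝ) + 1)
    have hε : 0 < ε := he m
    obtain ⟨hIc, hid⟩ := integral_mul_comp_sub_eq hU hb h01 hg hA hweak hσ hσ1 hM hσf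
      (fun x hx => (hσs x hx).2) (hχ ε hε) hε (hχ0 ε hε) (hχnn ε hε) (hχle ε hε) (hχ'u ε hε)
      (hCχ ε hε)
    set k : E n → ℝ → ℝ := fun x s => g x s + fderiv ℝ σ x (A x s) with hk
    have hkc : ∀ x ∈ U, ContinuousOn (k x) (Icc s₀ s₁) := by
      intro x hx
      refine ContinuousOn.add ?_ ((fderiv ℝ σ x).continuous.comp_continuousOn ?_)
      · exact hg.comp (f := fun s => (x, s)) (by fun_prop) fun s hs => ⟨subset_closure hx, hs⟩
      · exact hA.comp (f := fun s => (x, s)) (by fun_prop) fun s hs => ⟨subset_closure hx, hs⟩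
    have hχ'c : ∀ c, Continuous fun s => deriv (χ ε) (c - s) := fun c =>
      (hχ'u ε hε).continuous.comp (continuous_const.sub continuous_id)
    have hint1 : ∀ x ∈ U, ∫ s in s₀..s₁, deriv (χ ε) (σ x - s) = χ ε (σ x - s₀) := by
      intro x hx
      rw [intervalIntegral.integral_comp_sub_left (fun t => deriv (χ ε) t),
        intervalIntegral.integral_deriv_eq_sub
          (fun t _ => (hχ ε hε).differentiable one_ne_zero t)
          ((hχ'u ε hε).continuous.intervalIntegrable _ _),
        hχ0 ε hε (σ x - s₁) (by linarith [(hσs x hx).2]), sub_zero]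
    -- the difference between the smeared and the sharp flux through the graph
    have hdiff : ∀ x ∈ U, |χ ε (σ x - s₀) * k x (σ x)
        - ∫ s in s₀..s₁, k x s * deriv (χ ε) (σ x - s)| ≤ κ * (1 + M) := by
      intro x hx
      have hI1 : IntervalIntegrable (fun s => deriv (χ ε) (σ x - s)) volume s₀ s₁ :=
        (hχ'c _).intervalIntegrable _ _
      have hI2 : IntervalIntegrable (fun s => k x s * deriv (χ ε) (σ x - s)) volume s₀ s₁ := by
        refine ContinuousOn.intervalIntegrable ?_
        rw [uIcc_of_le h01.le]
        exact (hkc x hx).mul (hχ'c _).continuousOn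
      rw [← hint1 x hx, ← intervalIntegral.integral_mul_const,
        ← intervalIntegral.integral_sub (hI1.mul_const _) hI2]
      have hle : |∫ s in s₀..s₁, (deriv (χ ε) (σ x - s) * k x (σ x)
          - k x s * deriv (χ ε) (σ x - s))|
          ≤ ∫ s in s₀..s₁, κ * (1 + M) * deriv (χ ε) (σ x - s) := by
        rw [← Real.norm_eq_abs]
        refine intervalIntegral.norm_integral_le_of_norm_le h01.le ?_ (hI1.const_mul _)
        refine Filter.Eventually.of_forall fun s hs => ?_
        have hsI : s ∈ Icc s₀ s₁ := Ioc_subset_Icc_self hs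
        rw [show deriv (χ ε) (σ x - s) * k x (σ x) - k x s * deriv (χ ε) (σ x - s)
          = (k x (σ x) - k x s) * deriv (χ ε) (σ x - s) by ring, norm_mul,
          Real.norm_of_nonneg (hχ'nn ε hε _)]
        by_cases hin : σ x - s ∈ Icc ε (2 * ε)
        · refine mul_le_mul_of_nonneg_right ?_ (hχ'nn ε hε _)
          have hds : dist (x, σ x) (x, s) < min d₁ d₂ := by
            rw [Prod.dist_eq, dist_self, Real.dist_eq, max_eq_right (abs_nonneg _),
              abs_of_nonneg (hε.le.trans hin.1)]
            linarith [hin.2]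
          have m1 : (x, σ x) ∈ closure U ×ˢ Icc s₀ s₁ := ⟨subset_closure hx, hσI x hx⟩
          have m2 : (x, s) ∈ closure U ×ˢ Icc s₀ s₁ := ⟨subset_closure hx, hsI⟩
          have n1 := hug _ m1 _ m2 (hds.trans_le (min_le_left _ _))
          have n2 := huA _ m1 _ m2 (hds.trans_le (min_le_right _ _))
          rw [dist_eq_norm] at n1 n2
          have e : k x (σ x) - k x s
              = (g x (σ x) - g x s) + fderiv ℝ σ x (A x (σ x) - A x s) := by
            simp only [hk, map_sub]; ring
          rw [e]
          refine (norm_add_le _ _).trans ?_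
          have n3 : ‖fderiv ℝ σ x (A x (σ x) - A x s)‖ ≤ M * κ :=
            ((fderiv ℝ σ x).le_opNorm _).trans
              (mul_le_mul (hM x hx) n2.le (norm_nonneg _) hM0)
          linarith [n1.le]
        · rw [hχ'0 ε hε _ hin, mul_zero, mul_zero]
      refine hle.trans ?_
      rw [intervalIntegral.integral_const_mul, hint1 x hx]
      exact mul_le_of_le_one_right (by positivity) (hχle ε hε _)
    have hIa : IntegrableOn (fun x => χ ε (σ x - s₀) * w x) U := by
      refine integrableOn_of_continuousOn_of_bounded hU hb ((hχσ m).mul hwc)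
        (C := Cg + Cg + M * CA) fun x hx => ?_
      rw [abs_mul, abs_of_nonneg (hχnn ε hε _)]
      exact (mul_le_of_le_one_left (abs_nonneg _) (hχle ε hε _)).trans (hwb x hx)
    have hIb : IntegrableOn (fun x => g x s₀ * χ ε (σ x - s₀)) U := by
      refine integrableOn_of_continuousOn_of_bounded hU hb (C := Cg)
        (ContinuousOn.mul ?_ (hχσ m)) fun x hx => ?_
      · exact hg.comp (f := fun x => (x, s₀)) (by fun_prop) fun x hx => ⟨subset_closure hx, hs₀⟩
      · rw [abs_mul, abs_of_nonneg (hχnn ε hε _)]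
        exact (mul_le_of_le_one_right (abs_nonneg _) (hχle ε hε _)).trans
          (hCg (x, s₀) ⟨subset_closure hx, hs₀⟩)
    have hsum : ∫ x in U, χ ε (σ x - s₀) * k x (σ x)
        = (∫ x in U, χ ε (σ x - s₀) * w x) + ∫ x in U, g x s₀ * χ ε (σ x - s₀) := by
      rw [← integral_add hIa hIb]
      congr 1; ext x; simp only [hk, hw]; ring
    have hIk : IntegrableOn (fun x => χ ε (σ x - s₀) * k x (σ x)) U := by
      refine (hIa.add hIb).congr (Filter.Eventually.of_forall fun x => ?_)
      simp only [hk, hw, Pi.add_apply]; ring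
    have hfinal : ∫ x in U, χ ε (σ x - s₀) * w x = ∫ x in U, (χ ε (σ x - s₀) * k x (σ x)
        - ∫ s in s₀..s₁, k x s * deriv (χ ε) (σ x - s)) := by
      rw [integral_sub hIk hIc, hsum, hid]; ring
    rw [hfinal]
    rw [← Real.norm_eq_abs]
    exact norm_setIntegral_le_of_norm_le_const hb.measure_lt_top hdiff
  refine abs_eq_zero.mp (le_antisymm (le_of_forall_pos_le_add fun κ hκ => ?_) (abs_nonneg _))
  have hB : 0 < (1 + M) * V + 1 := by positivity
  refine (hsmall (κ / ((1 + M) * V + 1)) (div_pos hκ hB)).trans ?_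
  rw [zero_add, mul_assoc, div_mul_eq_mul_div, div_le_iff₀ hB]
  nlinarith

/-- The integral over the part of `Ω` where `σ` is above the level `s₀`. -/
theorem setIntegral_superlevel_eq_zero {n : ℕ} {Ω : Set (E n)} (hΩ : IsOpen Ω)
    (hb : Bornology.IsBounded Ω) {s₀ s₁ : ℝ} (h01 : s₀ < s₁) {g : E n → ℝ → ℝ}
    {A : E n → ℝ → E n}
    (hg : ContinuousOn (fun p : E n × ℝ => g p.1 p.2) (closure Ω ×ˢ Icc s₀ s₁))
    (hA : ContinuousOn (fun p : E n × ℝ => A p.1 p.2) (closure Ω ×ˢ Icc s₀ s₁))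
    (hweak : IsWeakConservationLaw Ω (Icc s₀ s₁) g A) {σ : E n → ℝ}
    (hσ : ContinuousOn σ (closure Ω)) (hσ1 : ContDiffOn ℝ 1 σ Ω)
    {M : ℝ} (hM : ∀ x ∈ Ω, ‖fderiv ℝ σ x‖ ≤ M)
    (hσf : ∀ x ∈ frontier Ω, σ x = s₀) (hσs : ∀ x ∈ Ω, σ x ≤ s₁) :
    ∫ x in Ω ∩ σ ⁻¹' Ioi s₀, (g x (σ x) - g x s₀ + fderiv ℝ σ x (A x (σ x))) = 0 := by
  set U := Ω ∩ σ ⁻¹' Ioi s₀ with hUdef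
  have hUΩ : U ⊆ Ω := inter_subset_left
  have hcl : closure U ⊆ closure Ω := closure_mono hUΩ
  have hU : IsOpen U := (hσ.mono subset_closure).isOpen_inter_preimage hΩ isOpen_Ioi
  have hprod : closure U ×ˢ Icc s₀ s₁ ⊆ closure Ω ×ˢ Icc s₀ s₁ := prod_mono hcl le_rfl
  refine integral_graph_sub_level_eq_zero_of_lt hU (hb.subset hUΩ) h01 (hg.mono hprod)
    (hA.mono hprod) ?_ (hσ.mono hcl) (hσ1.mono hUΩ) (fun x hx => hM x (hUΩ hx)) ?_
    (fun x hx => ⟨hx.2, hσs x hx.1⟩)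
  · intro κ hκ
    obtain ⟨d, hd, h⟩ := hweak κ hκ
    exact ⟨d, hd, fun s hs s' hs' hss η h1 h2 h3 h4 => h s hs s' hs' hss η h1 h2 (h3.trans hUΩ) h4⟩
  · intro x hx
    rw [hU.frontier_eq] at hx
    by_cases hxΩ : x ∈ Ω
    · have hle : σ x ≤ s₀ := not_lt.mp fun h => hx.2 ⟨hxΩ, h⟩
      have hge : σ x ∈ closure (Ioi s₀) := by
        have hcw := ((hσ x (hcl hx.1)).mono (hUΩ.trans subset_closure)).mem_closure_image hx.1
        exact closure_mono (image_subset_iff.mpr fun y hy => hy.2) hcw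
      rw [closure_Ioi] at hge
      exact le_antisymm hle hge
    · exact hσf x (by rw [hΩ.frontier_eq]; exact ⟨hcl hx.1, hxΩ⟩)

/-- A weak conservation law `∂g/∂s = div A` integrated over the region between the level `s₀` and
the graph of a function `σ` with boundary values `s₀`. -/
theorem integral_graph_sub_level_eq_zero {n : ℕ} {Ω : Set (E n)} (hΩ : IsOpen Ω)
    (hb : Bornology.IsBounded Ω) {s₀ e : ℝ} (he : 0 < e) {g : E n → ℝ → ℝ}
    {A : E n → ℝ → E n}
    (hg : ContinuousOn (fun p : E n × ℝ => g p.1 p.2) (closure Ω ×ˢ Icc (s₀ - e) (s₀ + e)))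
    (hA : ContinuousOn (fun p : E n × ℝ => A p.1 p.2) (closure Ω ×ˢ Icc (s₀ - e) (s₀ + e)))
    (hweak : IsWeakConservationLaw Ω (Icc (s₀ - e) (s₀ + e)) g A) {σ : E n → ℝ}
    (hσ : ContinuousOn σ (closure Ω)) (hσ1 : ContDiffOn ℝ 1 σ Ω)
    {M : ℝ} (hM : ∀ x ∈ Ω, ‖fderiv ℝ σ x‖ ≤ M)
    (hσf : ∀ x ∈ frontier Ω, σ x = s₀) (hσs : ∀ x ∈ Ω, σ x ∈ Icc (s₀ - e) (s₀ + e)) :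
    ∫ x in Ω, (g x (σ x) - g x s₀ + fderiv ℝ σ x (A x (σ x))) = 0 := by
  have hsub : ∀ {α β : ℝ}, Icc α β ⊆ Icc (s₀ - e) (s₀ + e) →
      IsWeakConservationLaw Ω (Icc α β) g A := fun h κ hκ => by
    obtain ⟨d, hd, hw⟩ := hweak κ hκ
    exact ⟨d, hd, fun s hs s' hs' => hw s (h hs) s' (h hs')⟩
  have hup : Icc s₀ (s₀ + e) ⊆ Icc (s₀ - e) (s₀ + e) := Icc_subset_Icc_left (by linarith)
  have hpos := setIntegral_superlevel_eq_zero hΩ hb (by linarith : s₀ < s₀ + e)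
    (hg.mono (prod_mono le_rfl hup)) (hA.mono (prod_mono le_rfl hup)) (hsub hup) hσ hσ1 hM hσf
    (fun x hx => (hσs x hx).2)
  -- the part below the level is the part above it after the reflection `s ↦ 2 s₀ - s`
  have hrefl : ∀ {s}, s ∈ Icc s₀ (s₀ + e) → 2 * s₀ - s ∈ Icc (s₀ - e) (s₀ + e) := fun hs =>
    ⟨by linarith [hs.2], by linarith [hs.1]⟩
  have hmaps : MapsTo (fun p : E n × ℝ => (p.1, 2 * s₀ - p.2)) (closure Ω ×ˢ Icc s₀ (s₀ + e))
      (closure Ω ×ˢ Icc (s₀ - e) (s₀ + e)) := fun p hp => ⟨hp.1, hrefl hp.2⟩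
  have hfd : ∀ x, fderiv ℝ (fun x => 2 * s₀ - σ x) x = -fderiv ℝ σ x := fun x => by
    rw [fderiv_const_sub]
  have hneg := setIntegral_superlevel_eq_zero hΩ hb (by linarith : s₀ < s₀ + e)
    (g := fun x s => g x (2 * s₀ - s)) (A := fun x s => -A x (2 * s₀ - s))
    (σ := fun x => 2 * s₀ - σ x) (M := M)
    (hg.comp (by fun_prop) hmaps) (hA.comp (by fun_prop) hmaps).neg ?_
    (continuousOn_const.sub hσ) (contDiffOn_const.sub hσ1)
    (fun x hx => by rw [hfd, norm_neg]; exact hM x hx)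
    (fun x hx => by rw [hσf x hx]; ring) (fun x hx => by linarith [(hσs x hx).1])
  · set w : E n → ℝ := fun x => g x (σ x) - g x s₀ + fderiv ℝ σ x (A x (σ x)) with hw
    have hwU : IntegrableOn w Ω := by
      have hKc : IsCompact (closure Ω ×ˢ Icc (s₀ - e) (s₀ + e)) :=
        hb.isCompact_closure.prod isCompact_Icc
      obtain ⟨Cg, hCg⟩ := hKc.exists_bound_of_continuousOn hg
      obtain ⟨CA, hCA⟩ := hKc.exists_bound_of_continuousOn hA
      have hσU : ContinuousOn σ Ω := hσ.mono subset_closure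
      have hs₀ : s₀ ∈ Icc (s₀ - e) (s₀ + e) := ⟨by linarith, by linarith⟩
      have hpair : ContinuousOn (fun x => (x, σ x)) Ω := continuousOn_id.prodMk hσU
      have hm : MapsTo (fun x => (x, σ x)) Ω (closure Ω ×ˢ Icc (s₀ - e) (s₀ + e)) :=
        fun x hx => ⟨subset_closure hx, hσs x hx⟩
      have hm₀ : MapsTo (fun x => (x, s₀)) Ω (closure Ω ×ˢ Icc (s₀ - e) (s₀ + e)) :=
        fun x hx => ⟨subset_closure hx, hs₀⟩
      refine integrableOn_of_continuousOn_of_bounded hΩ hb (C := Cg + Cg + M * CA) ?_ ?_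
      · exact ((hg.comp hpair hm).sub (hg.comp (by fun_prop) hm₀)).add
          ((hσ1.continuousOn_fderiv_of_isOpen hΩ le_rfl).clm_apply (hA.comp hpair hm))
      · intro x hx
        have n1 : |g x (σ x)| ≤ Cg := hCg (x, σ x) (hm hx)
        have n2 : |g x s₀| ≤ Cg := hCg (x, s₀) (hm₀ hx)
        have n3 : ‖A x (σ x)‖ ≤ CA := hCA (x, σ x) (hm hx)
        have n4 : |fderiv ℝ σ x (A x (σ x))| ≤ M * CA :=
          ((fderiv ℝ σ x).le_opNorm _).trans (mul_le_mul (hM x hx) n3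
            (norm_nonneg _) ((norm_nonneg _).trans (hM x hx)))
        exact (abs_add_le _ _).trans (add_le_add ((abs_sub _ _).trans (add_le_add n1 n2)) n4)
    have hσU : ContinuousOn σ Ω := hσ.mono subset_closure
    have hmP : MeasurableSet (Ω ∩ σ ⁻¹' Ioi s₀) :=
      (hσU.isOpen_inter_preimage hΩ isOpen_Ioi).measurableSet
    have hmN : MeasurableSet (Ω ∩ σ ⁻¹' Iio s₀) :=
      (hσU.isOpen_inter_preimage hΩ isOpen_Iio).measurableSet
    have hset : Ω ∩ (fun x => 2 * s₀ - σ x) ⁻¹' Ioi s₀ = Ω ∩ σ ⁻¹' Iio s₀ := by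
      ext x
      simp only [mem_inter_iff, mem_preimage, mem_Ioi, mem_Iio, and_congr_right_iff]
      intro _
      constructor <;> intro h <;> linarith
    have hneg' : ∫ x in Ω ∩ σ ⁻¹' Iio s₀, w x = 0 := by
      rw [hset] at hneg
      rw [← hneg]
      congr 1; ext x
      simp only [hw, hfd, sub_sub_cancel, show 2 * s₀ - s₀ = s₀ by ring,
        neg_apply, map_neg, neg_neg]
    -- on the level itself the integrand vanishes almost everywhere
    have hzero : ∫ x in Ω \ (Ω ∩ σ ⁻¹' Ioi s₀ ∪ Ω ∩ σ ⁻¹' Iio s₀), w x = 0 := by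
      refine setIntegral_eq_zero_of_ae_eq_zero ?_
      filter_upwards [ae_fderiv_eq_zero_of_level hΩ hσ1 s₀] with x hx hmem
      have hxs : σ x = s₀ := by
        rcases lt_trichotomy (σ x) s₀ with h | h | h
        · exact absurd (Or.inr ⟨hmem.1, h⟩) hmem.2
        · exact h
        · exact absurd (Or.inl ⟨hmem.1, h⟩) hmem.2
      simp [hw, hx hmem.1 hxs, hxs]
    have hdisj : Disjoint (Ω ∩ σ ⁻¹' Ioi s₀) (Ω ∩ σ ⁻¹' Iio s₀) :=
      disjoint_left.mpr fun x h1 h2 => lt_asymm (show s₀ < σ x from h1.2) h2.2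
    have hsubset : Ω ∩ σ ⁻¹' Ioi s₀ ∪ Ω ∩ σ ⁻¹' Iio s₀ ⊆ Ω :=
      union_subset inter_subset_left inter_subset_left
    rw [setIntegral_sdiff (hmP.union hmN) hwU hsubset,
      setIntegral_union hdisj hmN (hwU.mono_set inter_subset_left)
        (hwU.mono_set inter_subset_left), hpos, hneg'] at hzero
    linarith
  · intro κ hκ
    obtain ⟨d, hd, hw⟩ := hweak κ hκ
    refine ⟨d, hd, fun s hs s' hs' hss η h1 h2 h3 h4 => ?_⟩
    have hdiff : |(2 * s₀ - s') - (2 * s₀ - s)| = |s' - s| := by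
      rw [show (2 * s₀ - s') - (2 * s₀ - s) = -(s' - s) by ring, abs_neg]
    have := hw _ (hrefl hs) _ (hrefl hs') (by rwa [hdiff]) η h1 h2 h3 h4
    rw [hdiff] at this
    refine le_trans (le_of_eq ?_) this
    congr 2
    simp only [map_neg]
    rw [integral_neg]; ring

noncomputable section

/-! ### Partial derivatives of the integrand and of the family -/

section Partials

variable {n : ℕ} {f : E n → ℝ → E n → ℝ} {O : Set (E n)}

theorem hasFDerivAt_integrand (hO : IsOpen O)
    (hf : ContDiffOn ℝ 1 (fun p : E n × ℝ × E n => f p.1 p.2.1 p.2.2) (O ×ˢ univ))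
    {x : E n} (hx : x ∈ O) (y : ℝ) (z : E n) :
    HasFDerivAt (fun p : E n × ℝ × E n => f p.1 p.2.1 p.2.2)
      (fderiv ℝ (fun p : E n × ℝ × E n => f p.1 p.2.1 p.2.2) (x, y, z)) (x, y, z) :=
  ((hf.contDiffAt ((hO.prod isOpen_univ).mem_nhds ⟨hx, mem_univ _⟩)).differentiableAt
    one_ne_zero).hasFDerivAt

theorem continuousOn_fderiv_integrand (hO : IsOpen O)
    (hf : ContDiffOn ℝ 1 (fun p : E n × ℝ × E n => f p.1 p.2.1 p.2.2) (O ×ˢ univ)) :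
    ContinuousOn (fderiv ℝ (fun p : E n × ℝ × E n => f p.1 p.2.1 p.2.2)) (O ×ˢ univ) :=
  hf.continuousOn_fderiv_of_isOpen (hO.prod isOpen_univ) le_rfl

theorem hasDerivAt_partialY (hO : IsOpen O)
    (hf : ContDiffOn ℝ 1 (fun p : E n × ℝ × E n => f p.1 p.2.1 p.2.2) (O ×ˢ univ))
    {x : E n} (hx : x ∈ O) (y : ℝ) (z : E n) :
    HasDerivAt (fun t => f x t z) (partialY f x y z) y ∧
      partialY f x y z =
        fderiv ℝ (fun p : E n × ℝ × E n => f p.1 p.2.1 p.2.2) (x, y, z) (0, 1, 0) := by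
  have h1 : HasDerivAt (fun t : ℝ => ((x, t, z) : E n × ℝ × E n)) (0, 1, 0) y :=
    (hasDerivAt_const y x).prodMk ((hasDerivAt_id' y).prodMk (hasDerivAt_const y z))
  have h2 := (hasFDerivAt_integrand hO hf hx y z).comp_hasDerivAt y h1
  have h3 : partialY f x y z = _ := h2.deriv
  exact ⟨h3 ▸ h2, h3⟩

theorem hasFDerivAt_gradZ (hO : IsOpen O)
    (hf : ContDiffOn ℝ 1 (fun p : E n × ℝ × E n => f p.1 p.2.1 p.2.2) (O ×ˢ univ))
    {x : E n} (hx : x ∈ O) (y : ℝ) (z : E n) :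
    HasFDerivAt (f x y) (InnerProductSpace.toDual ℝ (E n) (gradZ f x y z)) z ∧
      gradZ f x y z = (InnerProductSpace.toDual ℝ (E n)).symm
        ((fderiv ℝ (fun p : E n × ℝ × E n => f p.1 p.2.1 p.2.2) (x, y, z)).comp
          ((ContinuousLinearMap.inr ℝ (E n) (ℝ × E n)).comp
            (ContinuousLinearMap.inr ℝ ℝ (E n)))) := by
  have h1 : HasFDerivAt (fun w : E n => ((x, y, w) : E n × ℝ × E n))
      ((ContinuousLinearMap.inr ℝ (E n) (ℝ × E n)).comp (ContinuousLinearMap.inr ℝ ℝ (E n))) z :=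
    ((hasFDerivAt_const x z).prodMk ((hasFDerivAt_const y z).prodMk
      (hasFDerivAt_id z))).congr_fderiv (by ext <;> simp)
  have h2 := (hasFDerivAt_integrand hO hf hx y z).comp z h1
  have h3 : HasFDerivAt (f x y) _ z := h2
  have h4 : HasGradientAt (f x y) (gradZ f x y z) z := h3.differentiableAt.hasGradientAt
  refine ⟨hasGradientAt_iff_hasFDerivAt.mp h4, ?_⟩
  rw [gradZ, gradient, h3.fderiv]

theorem continuousOn_partialY (hO : IsOpen O)
    (hf : ContDiffOn ℝ 1 (fun p : E n × ℝ × E n => f p.1 p.2.1 p.2.2) (O ×ˢ univ)) :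
    ContinuousOn (fun p : E n × ℝ × E n => partialY f p.1 p.2.1 p.2.2) (O ×ˢ univ) :=
  ((continuousOn_fderiv_integrand hO hf).clm_apply continuousOn_const).congr
    fun p hp => (hasDerivAt_partialY hO hf hp.1 p.2.1 p.2.2).2

theorem continuousOn_gradZ (hO : IsOpen O)
    (hf : ContDiffOn ℝ 1 (fun p : E n × ℝ × E n => f p.1 p.2.1 p.2.2) (O ×ˢ univ)) :
    ContinuousOn (fun p : E n × ℝ × E n => gradZ f p.1 p.2.1 p.2.2) (O ×ˢ univ) :=
  ((InnerProductSpace.toDual ℝ (E n)).symm.continuous.comp_continuousOn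
    ((continuousOn_fderiv_integrand hO hf).clm_comp continuousOn_const)).congr
    fun p hp => (hasFDerivAt_gradZ hO hf hp.1 p.2.1 p.2.2).2

/-- The gradient inequality for a convex integrand. -/
theorem inner_gradZ_le_sub (hO : IsOpen O)
    (hf : ContDiffOn ℝ 1 (fun p : E n × ℝ × E n => f p.1 p.2.1 p.2.2) (O ×ˢ univ))
    {x : E n} (hx : x ∈ O) {y : ℝ} (hc : ConvexOn ℝ univ (f x y)) (w z : E n) :
    inner ℝ (gradZ f x y w) (z - w) ≤ f x y z - f x y w := by
  let γ : ℝ → E n := fun t => w + t • (z - w)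
  have hγ : HasDerivAt γ (z - w) 0 := by
    have h := ((hasDerivAt_id' (0 : ℝ)).smul_const (z - w)).const_add w
    rwa [one_smul] at h
  have hconv : ConvexOn ℝ univ (fun t => f x y (γ t)) := by
    refine ⟨convex_univ, fun a _ b _ p q hp hq hpq => ?_⟩
    have e : γ (p • a + q • b) = p • γ a + q • γ b := by
      simp only [γ, smul_eq_mul, smul_add, smul_smul, add_smul]
      have : w = p • w + q • w := by rw [← add_smul, hpq, one_smul]
      nth_rewrite 1 [this]
      abel
    simp only [e]
    exact hc.2 (mem_univ _) (mem_univ _) hp hq hpq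
  have h0 : HasFDerivAt (f x y) (InnerProductSpace.toDual ℝ (E n) (gradZ f x y w)) (γ 0) := by
    simpa [γ] using (hasFDerivAt_gradZ hO hf hx y w).1
  have hd : HasDerivAt (fun t => f x y (γ t)) (inner ℝ (gradZ f x y w) (z - w)) 0 :=
    h0.comp_hasDerivAt 0 hγ
  have := hconv.le_slope_of_hasDerivAt (mem_univ 0) (mem_univ 1) one_pos hd
  simpa [slope_def_field, γ] using this

end Partials

section FamilyPartials

variable {n : ℕ} {φ : E n → ℝ → ℝ} {O : Set (E n)} {T : Set ℝ}

theorem hasDerivAt_family (hO : IsOpen O) (hT : IsOpen T)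
    (hφ : ContDiffOn ℝ 1 (fun p : E n × ℝ => φ p.1 p.2) (O ×ˢ T)) {x : E n} (hx : x ∈ O) {s : ℝ}
    (hs : s ∈ T) :
    HasDerivAt (φ x) (deriv (φ x) s) s ∧
      deriv (φ x) s = fderiv ℝ (fun p : E n × ℝ => φ p.1 p.2) (x, s) (0, 1) := by
  have h0 : HasFDerivAt (fun p : E n × ℝ => φ p.1 p.2)
      (fderiv ℝ (fun p : E n × ℝ => φ p.1 p.2) (x, s)) (x, s) :=
    ((hφ.contDiffAt ((hO.prod hT).mem_nhds ⟨hx, hs⟩)).differentiableAt one_ne_zero).hasFDerivAt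
  have h1 : HasDerivAt (fun t : ℝ => ((x, t) : E n × ℝ)) (0, 1) s :=
    (hasDerivAt_const s x).prodMk (hasDerivAt_id' s)
  have h2 : HasDerivAt (φ x) _ s := h0.comp_hasDerivAt s h1
  exact ⟨h2.differentiableAt.hasDerivAt, h2.deriv⟩

theorem hasGradientAt_family (hO : IsOpen O) (hT : IsOpen T)
    (hφ : ContDiffOn ℝ 1 (fun p : E n × ℝ => φ p.1 p.2) (O ×ˢ T)) {x : E n} (hx : x ∈ O) {s : ℝ}
    (hs : s ∈ T) :
    HasGradientAt (fun t => φ t s) (gradient (fun t => φ t s) x) x ∧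
      gradient (fun t => φ t s) x = (InnerProductSpace.toDual ℝ (E n)).symm
        ((fderiv ℝ (fun p : E n × ℝ => φ p.1 p.2) (x, s)).comp
          (ContinuousLinearMap.inl ℝ (E n) ℝ)) := by
  have h0 : HasFDerivAt (fun p : E n × ℝ => φ p.1 p.2)
      (fderiv ℝ (fun p : E n × ℝ => φ p.1 p.2) (x, s)) (x, s) :=
    ((hφ.contDiffAt ((hO.prod hT).mem_nhds ⟨hx, hs⟩)).differentiableAt one_ne_zero).hasFDerivAt
  have h1 : HasFDerivAt (fun t : E n => ((t, s) : E n × ℝ))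
      (ContinuousLinearMap.inl ℝ (E n) ℝ) x :=
    (hasFDerivAt_id x).prodMk (hasFDerivAt_const s x)
  have h2 := h0.comp x h1
  have h3 : HasFDerivAt (fun t => φ t s) _ x := h2
  refine ⟨h3.differentiableAt.hasGradientAt, ?_⟩
  rw [gradient, h3.fderiv]

theorem continuousOn_deriv_family (hO : IsOpen O) (hT : IsOpen T)
    (hφ : ContDiffOn ℝ 1 (fun p : E n × ℝ => φ p.1 p.2) (O ×ˢ T)) :
    ContinuousOn (fun p : E n × ℝ => deriv (φ p.1) p.2) (O ×ˢ T) :=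
  ((hφ.continuousOn_fderiv_of_isOpen (hO.prod hT) le_rfl).clm_apply continuousOn_const).congr
    fun _ hp => (hasDerivAt_family hO hT hφ hp.1 hp.2).2

theorem continuousOn_gradient_family (hO : IsOpen O) (hT : IsOpen T)
    (hφ : ContDiffOn ℝ 1 (fun p : E n × ℝ => φ p.1 p.2) (O ×ˢ T)) :
    ContinuousOn (fun p : E n × ℝ => gradient (fun t => φ t p.2) p.1) (O ×ˢ T) :=
  ((InnerProductSpace.toDual ℝ (E n)).symm.continuous.comp_continuousOn
    ((hφ.continuousOn_fderiv_of_isOpen (hO.prod hT) le_rfl).clm_comp continuousOn_const)).congr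
    fun _ hp => (hasGradientAt_family hO hT hφ hp.1 hp.2).2

end FamilyPartials

/-! ### The conservation law satisfied by a family of stationary functions -/

/-- The momentum `x ↦ f_z(x, ψ(x), ∇ψ(x))` of the member `ψ = φ(·, s)` of the family. -/
def momentum {n : ℕ} (f : E n → ℝ → E n → ℝ) (φ : E n → ℝ → ℝ) (x : E n) (s : ℝ) : E n :=
  gradZ f x (φ x s) (gradient (fun t => φ t s) x)

/-- The Lagrangian density `x ↦ f(x, ψ(x), ∇ψ(x))` of the member `ψ = φ(·, s)` of the family. -/
def density {n : ℕ} (f : E n → ℝ → E n → ℝ) (φ : E n → ℝ → ℝ) (x : E n) (s : ℝ) : ℝ :=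
  f x (φ x s) (gradient (fun t => φ t s) x)

/-- The term `f_y(x, ψ(x), ∇ψ(x))` of the Euler-Lagrange equation of the member `ψ = φ(·, s)`. -/
def force {n : ℕ} (f : E n → ℝ → E n → ℝ) (φ : E n → ℝ → ℝ) (x : E n) (s : ℝ) : ℝ :=
  partialY f x (φ x s) (gradient (fun t => φ t s) x)

section Continuity

variable {n : ℕ} {f : E n → ℝ → E n → ℝ} {φ : E n → ℝ → ℝ} {O : Set (E n)} {T : Set ℝ}

theorem continuousOn_jet (hO : IsOpen O) (hT : IsOpen T)
    (hφ : ContDiffOn ℝ 1 (fun p : E n × ℝ => φ p.1 p.2) (O ×ˢ T)) :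
    ContinuousOn (fun p : E n × ℝ => (p.1, φ p.1 p.2, gradient (fun t => φ t p.2) p.1))
      (O ×ˢ T) :=
  continuousOn_fst.prodMk (hφ.continuousOn.prodMk (continuousOn_gradient_family hO hT hφ))

theorem continuousOn_momentum (hO : IsOpen O) (hT : IsOpen T)
    (hf : ContDiffOn ℝ 1 (fun p : E n × ℝ × E n => f p.1 p.2.1 p.2.2) (O ×ˢ univ))
    (hφ : ContDiffOn ℝ 1 (fun p : E n × ℝ => φ p.1 p.2) (O ×ˢ T)) :
    ContinuousOn (fun p : E n × ℝ => momentum f φ p.1 p.2) (O ×ˢ T) :=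
  (continuousOn_gradZ hO hf).comp (continuousOn_jet hO hT hφ) fun _ hp => ⟨hp.1, mem_univ _⟩

theorem continuousOn_density (hO : IsOpen O) (hT : IsOpen T)
    (hf : ContDiffOn ℝ 1 (fun p : E n × ℝ × E n => f p.1 p.2.1 p.2.2) (O ×ˢ univ))
    (hφ : ContDiffOn ℝ 1 (fun p : E n × ℝ => φ p.1 p.2) (O ×ˢ T)) :
    ContinuousOn (fun p : E n × ℝ => density f φ p.1 p.2) (O ×ˢ T) :=
  hf.continuousOn.comp (continuousOn_jet hO hT hφ) fun _ hp => ⟨hp.1, mem_univ _⟩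

theorem continuousOn_force (hO : IsOpen O) (hT : IsOpen T)
    (hf : ContDiffOn ℝ 1 (fun p : E n × ℝ × E n => f p.1 p.2.1 p.2.2) (O ×ˢ univ))
    (hφ : ContDiffOn ℝ 1 (fun p : E n × ℝ => φ p.1 p.2) (O ×ˢ T)) :
    ContinuousOn (fun p : E n × ℝ => force f φ p.1 p.2) (O ×ˢ T) :=
  (continuousOn_partialY hO hf).comp (continuousOn_jet hO hT hφ) fun _ hp => ⟨hp.1, mem_univ _⟩

end Continuity

end

noncomputable section

section Increments

variable {n : ℕ} {f : E n → ℝ → E n → ℝ} {φ : E n → ℝ → ℝ} {O K : Set (E n)} {T : Set ℝ}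
  {α β : ℝ}

/-- A function of the parameter whose derivative is close to `c` has increments close to those of
the linear function of slope `c`. -/
theorem abs_sub_sub_mul_le {h h' : ℝ → ℝ} {s s' c κ : ℝ}
    (hd : ∀ t ∈ uIcc s s', HasDerivAt h (h' t) t) (hb : ∀ t ∈ uIcc s s', |h' t - c| ≤ κ) :
    |h s' - h s - c * (s' - s)| ≤ κ * |s' - s| := by
  have := (convex_uIcc s s').norm_image_sub_le_of_norm_hasDerivWithin_le
    (f := fun t => h t - t * c) (f' := fun t => h' t - c) (C := κ)
    (fun t ht => by
      simpa using ((hd t ht).fun_sub ((hasDerivAt_id' t).mul_const c)).hasDerivWithinAt)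
    (fun t ht => hb t ht) left_mem_uIcc right_mem_uIcc
  simp only [Real.norm_eq_abs] at this
  refine le_trans (le_of_eq ?_) this
  congr 1; ring

/-- The increments of the family in the parameter, to first order and uniformly. -/
theorem exists_family_increment_le (hO : IsOpen O) (hT : IsOpen T) (hK : IsCompact K) (hKO : K ⊆ O)
    (hJ : Icc α β ⊆ T)
    (hφ : ContDiffOn ℝ 1 (fun p : E n × ℝ => φ p.1 p.2) (O ×ˢ T)) {κ : ℝ} (hκ : 0 < κ) :
    ∃ d > 0, ∀ s ∈ Icc α β, ∀ s' ∈ Icc α β, |s' - s| < d → ∀ x ∈ K,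
      |φ x s' - φ x s - deriv (φ x) s * (s' - s)| ≤ κ * |s' - s| := by
  have huc := (hK.prod (isCompact_Icc (a := α) (b := β))).uniformContinuousOn_of_continuous
    ((continuousOn_deriv_family hO hT hφ).mono (prod_mono hKO hJ))
  obtain ⟨d, hd, h⟩ := Metric.uniformContinuousOn_iff.mp huc κ hκ
  refine ⟨d, hd, fun s hs s' hs' hss x hx => ?_⟩
  have hsub : uIcc s s' ⊆ Icc α β := uIcc_subset_Icc hs hs'
  refine abs_sub_sub_mul_le (fun t ht => (hasDerivAt_family hO hT hφ (hKO hx) (hJ (hsub ht))).1)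
    fun t ht => ?_
  have := h (x, t) ⟨hx, hsub ht⟩ (x, s) ⟨hx, hs⟩ (by
    rw [Prod.dist_eq, dist_self, Real.dist_eq, max_eq_right (abs_nonneg _)]
    exact (abs_sub_left_of_mem_uIcc ht).trans_lt hss)
  rw [Real.dist_eq] at this
  exact this.le

/-- The increments of the integrand in `y` along the family, to first order and uniformly; the
gradient is that of the new member, the slope is taken at the old one. -/
theorem exists_integrand_increment_le (hO : IsOpen O) (hT : IsOpen T) (hK : IsCompact K)
    (hKO : K ⊆ O) (hJ : Icc α β ⊆ T)
    (hf : ContDiffOn ℝ 1 (fun p : E n × ℝ × E n => f p.1 p.2.1 p.2.2) (O ×ˢ univ))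
    (hφ : ContDiffOn ℝ 1 (fun p : E n × ℝ => φ p.1 p.2) (O ×ˢ T)) {κ : ℝ} (hκ : 0 < κ) :
    ∃ d > 0, ∀ s ∈ Icc α β, ∀ s' ∈ Icc α β, |s' - s| < d → ∀ x ∈ K,
      |density f φ x s' - f x (φ x s) (gradient (fun t => φ t s') x)
        - force f φ x s * (φ x s' - φ x s)| ≤ κ * |s' - s| := by
  have hKJ := hK.prod (isCompact_Icc (a := α) (b := β))
  obtain ⟨M, hM⟩ := hKJ.exists_bound_of_continuousOn
    ((continuousOn_deriv_family hO hT hφ).mono (prod_mono hKO hJ))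
  have hlip : ∀ s ∈ Icc α β, ∀ s' ∈ Icc α β, ∀ x ∈ K, |φ x s' - φ x s| ≤ |M| * |s' - s| := by
    intro s hs s' hs' x hx
    have hsub : uIcc s s' ⊆ Icc α β := uIcc_subset_Icc hs hs'
    have := abs_sub_sub_mul_le (h := φ x) (c := 0) (κ := |M|) (s := s) (s' := s')
      (fun t ht => (hasDerivAt_family hO hT hφ (hKO hx) (hJ (hsub ht))).1)
      (fun t ht => by
        rw [sub_zero]
        exact (hM (x, t) ⟨hx, hsub ht⟩).trans (le_abs_self M))
    simpa using this
  let S : Set ((E n × ℝ × ℝ) × ℝ) := (K ×ˢ Icc α β ×ˢ Icc α β) ×ˢ Icc 0 1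
  have hS : IsCompact S := (hK.prod (isCompact_Icc.prod isCompact_Icc)).prod isCompact_Icc
  -- the slope in `y` along the segment from `φ(x, s)` to `φ(x, s')`
  let Θ : (E n × ℝ × ℝ) × ℝ → ℝ := fun p => partialY f p.1.1
    (φ p.1.1 p.1.2.1 + p.2 * (φ p.1.1 p.1.2.2 - φ p.1.1 p.1.2.1))
    (gradient (fun t => φ t p.1.2.2) p.1.1)
  have hΘ : ContinuousOn Θ S := by
    have m1 : MapsTo (fun p : (E n × ℝ × ℝ) × ℝ => (p.1.1, p.1.2.1)) S (O ×ˢ T) :=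
      fun p hp => ⟨hKO hp.1.1, hJ hp.1.2.1⟩
    have m2 : MapsTo (fun p : (E n × ℝ × ℝ) × ℝ => (p.1.1, p.1.2.2)) S (O ×ˢ T) :=
      fun p hp => ⟨hKO hp.1.1, hJ hp.1.2.2⟩
    have c1 : ContinuousOn (fun p : (E n × ℝ × ℝ) × ℝ => φ p.1.1 p.1.2.1) S :=
      hφ.continuousOn.comp (by fun_prop) m1
    have c2 : ContinuousOn (fun p : (E n × ℝ × ℝ) × ℝ => φ p.1.1 p.1.2.2) S :=
      hφ.continuousOn.comp (by fun_prop) m2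
    have c3 : ContinuousOn (fun p : (E n × ℝ × ℝ) × ℝ =>
        gradient (fun t => φ t p.1.2.2) p.1.1) S :=
      (continuousOn_gradient_family hO hT hφ).comp (by fun_prop) m2
    have c4 : ContinuousOn (fun p : (E n × ℝ × ℝ) × ℝ => (p.1.1,
        φ p.1.1 p.1.2.1 + p.2 * (φ p.1.1 p.1.2.2 - φ p.1.1 p.1.2.1),
        gradient (fun t => φ t p.1.2.2) p.1.1)) S :=
      (continuousOn_fst.fst).prodMk ((c1.add (continuousOn_snd.mul (c2.sub c1))).prodMk c3)
    exact (continuousOn_partialY hO hf).comp c4 fun p hp => ⟨hKO hp.1.1, mem_univ _⟩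
  have hκ' : 0 < κ / (|M| + 1) := by positivity
  obtain ⟨d, hd, h⟩ := Metric.uniformContinuousOn_iff.mp
    (hS.uniformContinuousOn_of_continuous hΘ) _ hκ'
  refine ⟨d, hd, fun s hs s' hs' hss x hx => ?_⟩
  set ψ := φ x s' - φ x s with hψ
  set z := gradient (fun t => φ t s') x with hz
  have key := abs_sub_sub_mul_le (h := fun τ => f x (φ x s + τ * ψ) z)
    (h' := fun τ => Θ ((x, s, s'), τ) * ψ) (s := 0) (s' := 1) (c := force f φ x s * ψ)
    (κ := κ / (|M| + 1) * |ψ|) ?_ ?_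
  · simp only [one_mul, zero_mul, add_zero, sub_zero, mul_one, abs_one] at key
    have e : φ x s + ψ = φ x s' := by rw [hψ]; ring
    rw [e] at key
    refine key.trans ?_
    have h1 := hlip s hs s' hs' x hx
    calc κ / (|M| + 1) * |ψ| ≤ κ / (|M| + 1) * ((|M| + 1) * |s' - s|) := by
          gcongr
          refine h1.trans ?_
          gcongr
          linarith
      _ = κ * |s' - s| := by field_simp
  · intro τ _
    have h1 : HasDerivAt (fun τ : ℝ => φ x s + τ * ψ) ψ τ := by
      simpa using ((hasDerivAt_id' τ).mul_const ψ).const_add (φ x s)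
    exact (hasDerivAt_partialY hO hf (hKO hx) (φ x s + τ * ψ) z).1.comp τ h1
  · intro τ hτ
    rw [uIcc_of_le zero_le_one] at hτ
    have hdist := h ((x, s, s'), τ) ⟨⟨hx, hs, hs'⟩, hτ⟩ ((x, s, s), τ) ⟨⟨hx, hs, hs⟩, hτ⟩ (by
      simp only [Prod.dist_eq, dist_self, Real.dist_eq]
      simpa using hss)
    rw [Real.dist_eq] at hdist
    have e : Θ ((x, s, s), τ) = force f φ x s := by simp [Θ, force]
    rw [e] at hdist
    rw [← sub_mul, abs_mul]
    exact mul_le_mul_of_nonneg_right hdist.le (abs_nonneg _)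

end Increments

theorem integrable_of_continuousOn_of_tsupport {n : ℕ} {O : Set (E n)} (hO : IsOpen O)
    {η : E n → ℝ} (hc : HasCompactSupport η) (hs : tsupport η ⊆ O) {w : E n → ℝ}
    (hw0 : ∀ x ∉ tsupport η, w x = 0) (hw : ContinuousOn w O) : Integrable w :=
  (continuous_of_continuousOn_of_eq_zero_off hO (isClosed_tsupport η) hs hw0
    hw).integrable_of_hasCompactSupport (HasCompactSupport.intro hc hw0)

/-- The lower bound for the increment of `∫ η f(x, φ, ∇φ)` from the member `s` to the member `s'`.
The integrand is split as `f(x, φ', ∇φ') - f(x, φ, ∇φ') + f(x, φ, ∇φ') - f(x, φ, ∇φ)`; the second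
difference is bounded below by convexity, and the Euler-Lagrange equation of the member `s`, tested
with `η (φ' - φ)`, removes the gradients of the members, which need not depend differentiably on
the parameter. -/
theorem neg_le_integral_mul_density_sub {n : ℕ} (hn : 0 < n) {f : E n → ℝ → E n → ℝ}
    {φ : E n → ℝ → ℝ} {O Ω : Set (E n)} {T : Set ℝ} (hO : IsOpen O) (hT : IsOpen T) (hΩO : Ω ⊆ O)
    (hf : ContDiffOn ℝ 1 (fun p : E n × ℝ × E n => f p.1 p.2.1 p.2.2) (O ×ˢ univ))
    (hφ : ContDiffOn ℝ 1 (fun p : E n × ℝ => φ p.1 p.2) (O ×ˢ T))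
    (hconv : ∀ x ∈ Ω, ∀ y : ℝ, ConvexOn ℝ univ (f x y)) {s s' : ℝ} (hs : s ∈ T) (hs' : s' ∈ T)
    (hp : DifferentiableOn ℝ (fun x => momentum f φ x s) O)
    (hdiv : ∀ x ∈ O, ∑ k : Fin n, (fderiv ℝ (fun x => momentum f φ x s) x
      (EuclideanSpace.single k 1)) k = force f φ x s)
    {c : ℝ} {A : E n → E n} (hA : ContinuousOn A O)
    (h1 : ∀ x ∈ Ω, |density f φ x s' - f x (φ x s) (gradient (fun t => φ t s') x)
        - force f φ x s * (φ x s' - φ x s)| ≤ c)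
    (h2 : ∀ x ∈ Ω, ‖(φ x s' - φ x s) • momentum f φ x s - (s' - s) • A x‖ ≤ c)
    {η : E n → ℝ} (hη : ContDiff ℝ 1 η) (hc : HasCompactSupport η) (hsupp : tsupport η ⊆ Ω)
    (hη0 : ∀ x, 0 ≤ η x) :
    -(s' - s) * (∫ x, fderiv ℝ η x (A x)) - c * ∫ x, (η x + ‖fderiv ℝ η x‖)
      ≤ ∫ x, η x * (density f φ x s' - density f φ x s) := by
  have hsO : tsupport η ⊆ O := hsupp.trans hΩO
  have h0 : ∀ x ∉ tsupport η, η x = 0 ∧ fderiv ℝ η x = 0 := fun x hx =>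
    ⟨image_eq_zero_of_notMem_tsupport hx,
      image_eq_zero_of_notMem_tsupport fun h => hx (tsupport_fderiv_subset ℝ h)⟩
  have hdη : Continuous (fderiv ℝ η) := hη.continuous_fderiv one_ne_zero
  have hslice : ∀ {t}, t ∈ T → MapsTo (fun x : E n => (x, t)) O (O ×ˢ T) :=
    fun ht x hx => ⟨hx, ht⟩
  have hφs : ∀ {t}, t ∈ T → ContDiffOn ℝ 1 (fun x => φ x t) O := fun {t} ht =>
    hφ.comp (contDiff_prodMk_left t).contDiffOn (hslice ht)
  set ψ : E n → ℝ := fun x => φ x s' - φ x s with hψ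
  have hψ1 : ContDiffOn ℝ 1 ψ O := (hφs hs').sub (hφs hs)
  let u : E n → ℝ := fun x => η x * ψ x
  have hu0 : ∀ x ∉ tsupport η, u x = 0 := fun x hx => by simp [u, (h0 x hx).1]
  have hutsupp : tsupport u ⊆ tsupport η :=
    closure_minimal (fun x hx => by_contra fun h => hx (hu0 x h)) (isClosed_tsupport η)
  have hu : ContDiff ℝ 1 u := by
    rw [contDiff_iff_contDiffAt]
    intro x
    by_cases hx : x ∈ tsupport η
    · exact hη.contDiffAt.mul (hψ1.contDiffAt (hO.mem_nhds (hsO hx)))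
    · refine (contDiffAt_const (c := (0 : ℝ))).congr_of_eventuallyEq ?_
      filter_upwards [(isClosed_tsupport η).isOpen_compl.mem_nhds hx] with y hy using hu0 y hy
  have hfc : ContinuousOn (fun x => force f φ x s) O :=
    (continuousOn_force hO hT hf hφ).comp (f := fun x : E n => (x, s)) (by fun_prop) (hslice hs)
  have hdens : ∀ {t}, t ∈ T → ContinuousOn (fun x => density f φ x t) O := fun {t} ht =>
    (continuousOn_density hO hT hf hφ).comp (f := fun x : E n => (x, t)) (by fun_prop) (hslice ht)
  obtain ⟨hW1, hW2⟩ := integral_fderiv_add_mul_eq_zero hn hO hp hfc hdiv hu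
    (HasCompactSupport.intro hc hu0) (hutsupp.trans hsO)
  set W : E n → ℝ := fun x => fderiv ℝ u x (momentum f φ x s) + u x * force f φ x s with hW
  have hI1 : Integrable (fun x => fderiv ℝ η x (A x)) :=
    integrable_of_continuousOn_of_tsupport hO hc hsO (fun x hx => by simp [h0 x hx])
      (hdη.continuousOn.clm_apply hA)
  have hI2 : Integrable (fun x => η x + ‖fderiv ℝ η x‖) :=
    integrable_of_continuousOn_of_tsupport hO hc hsO (fun x hx => by simp [h0 x hx])
      (hη.continuous.add hdη.norm).continuousOn
  have hI3 : Integrable (fun x => η x * (density f φ x s' - density f φ x s)) :=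
    integrable_of_continuousOn_of_tsupport hO hc hsO (fun x hx => by simp [h0 x hx])
      (hη.continuous.continuousOn.mul ((hdens hs').sub (hdens hs)))
  have hlow : ∀ x, W x - (s' - s) * fderiv ℝ η x (A x) - c * (η x + ‖fderiv ℝ η x‖)
      ≤ η x * (density f φ x s' - density f φ x s) := by
    intro x
    by_cases hx : x ∈ tsupport η
    · have hxΩ := hsupp hx
      have hxO := hΩO hxΩ
      have hψx : HasFDerivAt ψ (fderiv ℝ ψ x) x :=
        ((hψ1.contDiffAt (hO.mem_nhds hxO)).differentiableAt one_ne_zero).hasFDerivAt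
      have hux : fderiv ℝ u x = η x • fderiv ℝ ψ x + ψ x • fderiv ℝ η x :=
        ((hη.differentiable one_ne_zero x).hasFDerivAt.mul hψx).fderiv
      set z := gradient (fun t => φ t s) x with hz
      set z' := gradient (fun t => φ t s') x with hz'
      have hψp : fderiv ℝ ψ x (momentum f φ x s) = inner ℝ (momentum f φ x s) (z' - z) := by
        have g1 := hasGradientAt_iff_hasFDerivAt.mp (hasGradientAt_family hO hT hφ hxO hs').1
        have g2 := hasGradientAt_iff_hasFDerivAt.mp (hasGradientAt_family hO hT hφ hxO hs).1
        rw [(g1.fun_sub g2).fderiv, ← hz, ← hz', ← map_sub, InnerProductSpace.toDual_apply_apply,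
          real_inner_comm]
      have hcx : inner ℝ (momentum f φ x s) (z' - z) ≤ f x (φ x s) z' - density f φ x s :=
        inner_gradZ_le_sub hO hf hxO (hconv x hxΩ _) z z'
      have hr1 := (abs_le.mp (h1 x hxΩ)).1
      have hr2 : ψ x * fderiv ℝ η x (momentum f φ x s) - (s' - s) * fderiv ℝ η x (A x)
          ≤ c * ‖fderiv ℝ η x‖ := by
        have e : ψ x * fderiv ℝ η x (momentum f φ x s) - (s' - s) * fderiv ℝ η x (A x)
            = fderiv ℝ η x (ψ x • momentum f φ x s - (s' - s) • A x) := by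
          simp [map_sub, map_smul]
        rw [e]
        refine le_of_abs_le (((fderiv ℝ η x).le_opNorm _).trans ?_)
        rw [mul_comm]
        exact mul_le_mul_of_nonneg_right (h2 x hxΩ) (norm_nonneg _)
      have hWx : W x = η x * inner ℝ (momentum f φ x s) (z' - z)
          + ψ x * fderiv ℝ η x (momentum f φ x s) + η x * ψ x * force f φ x s := by
        simp only [hW, hux, u, add_apply, smul_apply, smul_eq_mul, hψp]
      rw [hWx]
      have hsum : inner ℝ (momentum f φ x s) (z' - z) + force f φ x s * ψ x - c
          ≤ density f φ x s' - density f φ x s := by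
        simp only [hψ] at hr1 ⊢
        linarith
      have := mul_le_mul_of_nonneg_left hsum (hη0 x)
      linarith
    · have : fderiv ℝ u x = 0 :=
        image_eq_zero_of_notMem_tsupport fun h => hx (hutsupp (tsupport_fderiv_subset ℝ h))
      simp [hW, this, h0 x hx, hu0 x hx]
  have := integral_mono ((hW1.sub (hI1.const_mul (s' - s))).sub (hI2.const_mul c)) hI3 hlow
  rw [integral_sub' (hW1.sub (hI1.const_mul (s' - s))) (hI2.const_mul c),
    integral_sub' hW1 (hI1.const_mul (s' - s)), hW2, integral_const_mul, integral_const_mul] at this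
  linarith

/-- A family of stationary functions satisfies the conservation law
`∂/∂s f(x, φ, ∇φ) = div (φ_s f_z(x, φ, ∇φ))`, although both sides exist only in the weak sense. -/
theorem isWeakConservationLaw_of_stationary {n : ℕ} (hn : 0 < n) {f : E n → ℝ → E n → ℝ}
    {φ : E n → ℝ → ℝ} {O Ω : Set (E n)} {T : Set ℝ} {α β : ℝ} (hO : IsOpen O) (hT : IsOpen T)
    (hb : Bornology.IsBounded Ω) (hΩO : closure Ω ⊆ O) (hJ : Icc α β ⊆ T)
    (hf : ContDiffOn ℝ 1 (fun p : E n × ℝ × E n => f p.1 p.2.1 p.2.2) (O ×ˢ univ))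
    (hφ : ContDiffOn ℝ 1 (fun p : E n × ℝ => φ p.1 p.2) (O ×ˢ T))
    (hconv : ∀ x ∈ Ω, ∀ y : ℝ, ConvexOn ℝ univ (f x y))
    (hp : ∀ s ∈ Icc α β, DifferentiableOn ℝ (fun x => momentum f φ x s) O)
    (hdiv : ∀ s ∈ Icc α β, ∀ x ∈ O, ∑ k : Fin n, (fderiv ℝ (fun x => momentum f φ x s) x
      (EuclideanSpace.single k 1)) k = force f φ x s) :
    IsWeakConservationLaw Ω (Icc α β) (density f φ)
      (fun x s => deriv (φ x) s • momentum f φ x s) := by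
  have hK : IsCompact (closure Ω) := hb.isCompact_closure
  have hKJ : IsCompact (closure Ω ×ˢ Icc α β) := hK.prod isCompact_Icc
  have hKJO : closure Ω ×ˢ Icc α β ⊆ O ×ˢ T := prod_mono hΩO hJ
  have hΩO' : Ω ⊆ O := subset_closure.trans hΩO
  set A : E n → ℝ → E n := fun x s => deriv (φ x) s • momentum f φ x s with hAdef
  have hAc : ContinuousOn (fun p : E n × ℝ => A p.1 p.2) (O ×ˢ T) :=
    (continuousOn_deriv_family hO hT hφ).smul (continuousOn_momentum hO hT hf hφ)
  obtain ⟨P, hP⟩ := hKJ.exists_bound_of_continuousOn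
    ((continuousOn_momentum hO hT hf hφ).mono hKJO)
  intro κ hκ
  have hκ2 : 0 < κ / 2 := half_pos hκ
  have hκP : 0 < κ / 2 / (|P| + 1) := by positivity
  obtain ⟨d₁, hd₁, H1⟩ := exists_integrand_increment_le hO hT hK hΩO hJ hf hφ hκ2
  obtain ⟨d₂, hd₂, H2⟩ := exists_family_increment_le hO hT hK hΩO hJ hφ hκP
  obtain ⟨d₃, hd₃, H3⟩ := Metric.uniformContinuousOn_iff.mp
    (hKJ.uniformContinuousOn_of_continuous (hAc.mono hKJO)) _ hκ2
  refine ⟨min d₁ (min d₂ d₃), lt_min hd₁ (lt_min hd₂ hd₃), ?_⟩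
  intro s hs s' hs' hss η h1 h2 h3 h4
  rw [lt_min_iff, lt_min_iff] at hss
  have hss' : |s - s'| < d₁ ∧ |s - s'| < d₂ ∧ |s - s'| < d₃ := by rwa [abs_sub_comm]
  have hAs : ∀ t ∈ Icc α β, ContinuousOn (fun x => A x t) O := fun t ht =>
    hAc.comp (f := fun x : E n => (x, t)) (by fun_prop) fun x hx => ⟨hx, hJ ht⟩
  have hmom : ∀ t ∈ Icc α β, ∀ t' ∈ Icc α β, |t' - t| < d₂ → ∀ x ∈ Ω,
      ‖(φ x t' - φ x t) • momentum f φ x t - (t' - t) • A x t‖ ≤ κ / 2 * |t' - t| := by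
    intro t ht t' ht' htt x hx
    have e : (φ x t' - φ x t) • momentum f φ x t - (t' - t) • A x t
        = (φ x t' - φ x t - deriv (φ x) t * (t' - t)) • momentum f φ x t := by
      simp only [hAdef, smul_smul, sub_smul, mul_comm]
    rw [e, norm_smul, Real.norm_eq_abs]
    have b1 := H2 t ht t' ht' htt x (subset_closure hx)
    have b2 : ‖momentum f φ x t‖ ≤ |P| + 1 :=
      (hP (x, t) ⟨subset_closure hx, ht⟩).trans (by linarith [le_abs_self P])
    refine (mul_le_mul b1 b2 (norm_nonneg _) (by positivity)).trans_eq ?_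
    field_simp
  have low := neg_le_integral_mul_density_sub hn hO hT hΩO' hf hφ hconv (hJ hs) (hJ hs')
    (hp s hs) (hdiv s hs) (hAs s hs) (fun x hx => H1 s hs s' hs' hss.1 x (subset_closure hx))
    (hmom s hs s' hs' hss.2.1) h1 h2 h3 h4
  -- the upper bound is the lower bound with the two members exchanged
  have upp := neg_le_integral_mul_density_sub hn hO hT hΩO' hf hφ hconv (hJ hs') (hJ hs)
    (hp s' hs') (hdiv s' hs') (hAs s' hs')
    (fun x hx => H1 s' hs' s hs hss'.1 x (subset_closure hx))
    (hmom s' hs' s hs hss'.2.1) h1 h2 h3 h4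
  have hflip : ∫ x, η x * (density f φ x s - density f φ x s')
      = -∫ x, η x * (density f φ x s' - density f φ x s) := by
    rw [← integral_neg]
    congr 1; ext x; ring
  have hdη : Continuous (fderiv ℝ η) := h1.continuous_fderiv one_ne_zero
  have h0 : ∀ x ∉ tsupport η, η x = 0 ∧ fderiv ℝ η x = 0 := fun x hx =>
    ⟨image_eq_zero_of_notMem_tsupport hx,
      image_eq_zero_of_notMem_tsupport fun h => hx (tsupport_fderiv_subset ℝ h)⟩
  have hIA : ∀ t ∈ Icc α β, Integrable (fun x => fderiv ℝ η x (A x t)) := fun t ht =>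
    integrable_of_continuousOn_of_tsupport hO h2 (h3.trans hΩO') (fun x hx => by simp [h0 x hx])
      (hdη.continuousOn.clm_apply (hAs t ht))
  have hIη : Integrable (fun x => η x + ‖fderiv ℝ η x‖) :=
    integrable_of_continuousOn_of_tsupport hO h2 (h3.trans hΩO') (fun x hx => by simp [h0 x hx])
      (h1.continuous.add hdη.norm).continuousOn
  set N := ∫ x, (η x + ‖fderiv ℝ η x‖) with hN
  have hAdiff : |(∫ x, fderiv ℝ η x (A x s')) - ∫ x, fderiv ℝ η x (A x s)| ≤ κ / 2 * N := by
    rw [← integral_sub (hIA s' hs') (hIA s hs), ← Real.norm_eq_abs, hN, ← integral_const_mul]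
    refine norm_integral_le_of_norm_le (hIη.const_mul _) (Filter.Eventually.of_forall fun x => ?_)
    by_cases hx : x ∈ tsupport η
    · have hxΩ := subset_closure (h3 hx)
      have := H3 (x, s') ⟨hxΩ, hs'⟩ (x, s) ⟨hxΩ, hs⟩ (by
        rw [Prod.dist_eq, dist_self, Real.dist_eq, max_eq_right (abs_nonneg _)]
        exact hss.2.2)
      rw [dist_eq_norm] at this
      rw [← map_sub]
      refine ((fderiv ℝ η x).le_opNorm _).trans ?_
      have g1 := mul_le_mul_of_nonneg_left this.le (norm_nonneg (fderiv ℝ η x))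
      have g2 : 0 ≤ κ / 2 * η x := mul_nonneg hκ2.le (h4 x)
      simp only at g1
      linarith
    · simp [h0 x hx]
  rw [hflip, abs_sub_comm s s'] at upp
  have hN0 : 0 ≤ N := integral_nonneg fun x => add_nonneg (h4 x) (norm_nonneg _)
  have hprod : (s' - s) * ((∫ x, fderiv ℝ η x (A x s)) - ∫ x, fderiv ℝ η x (A x s'))
      ≤ |s' - s| * (κ / 2 * N) := by
    refine (le_abs_self _).trans ?_
    rw [abs_mul, abs_sub_comm (∫ x, fderiv ℝ η x (A x s))]
    exact mul_le_mul_of_nonneg_left hAdiff (abs_nonneg _)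
  have hnn : 0 ≤ κ / 2 * |s' - s| * N := by positivity
  rw [abs_le]
  constructor
  · linarith
  · linarith

end

noncomputable section

/-! ### Geometry of the covered region -/

theorem isClosed_box {n : ℕ} (a b : Fin n → ℝ) : IsClosed (box a b) := by
  have : box a b = ⋂ k, (fun x : E n => x k) ⁻¹' Icc (a k) (b k) := by
    ext x; simp [box]
  rw [this]
  refine isClosed_iInter fun k => isClosed_Icc.preimage ?_
  fun_prop

/-- A member of a stationary family satisfies the Euler-Lagrange equation in the interior of the
set on which it is given, where derivatives within the set are plain derivatives. -/
theorem IsStationaryFor.momentum_interior {n : ℕ} {f : E n → ℝ → E n → ℝ} {B : Set (E n)}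
    {φ : E n → ℝ → ℝ} {s : ℝ} (h : IsStationaryFor f B (fun x => φ x s)) :
    DifferentiableOn ℝ (fun x => momentum f φ x s) (interior B) ∧
      ∀ x ∈ interior B, ∑ k : Fin n, (fderiv ℝ (fun x => momentum f φ x s) x
        (EuclideanSpace.single k 1)) k = force f φ x s := by
  have hgrad : ∀ x ∈ interior B,
      gradientWithin (fun t => φ t s) B x = gradient (fun t => φ t s) x := fun x hx => by
    rw [gradientWithin, gradient, fderivWithin_of_mem_nhds (mem_interior_iff_mem_nhds.mp hx)]
  have heq : EqOn (fun x => momentum f φ x s)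
      (fun x => gradZ f x (φ x s) (gradientWithin (fun t => φ t s) B x)) (interior B) :=
    fun x hx => by simp only [momentum, hgrad x hx]
  refine ⟨(h.2.1.mono interior_subset).congr heq, fun x hx => ?_⟩
  have hx' := h.2.2 x (interior_subset hx)
  rw [divergenceWithin, fderivWithin_of_mem_nhds (mem_interior_iff_mem_nhds.mp hx),
    hgrad x hx] at hx'
  rw [(heq.eventuallyEq_of_mem (isOpen_interior.mem_nhds hx)).fderiv_eq]
  exact hx'

theorem injOn_of_deriv_ne_zero {h : ℝ → ℝ} {α β : ℝ}
    (hd : ∀ s ∈ Icc α β, DifferentiableAt ℝ h s) (hne : ∀ s ∈ Icc α β, deriv h s ≠ 0) :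
    InjOn h (Icc α β) := by
  have key : ∀ u ∈ Icc α β, ∀ v ∈ Icc α β, u < v → h u ≠ h v := by
    intro u hu v hv huv heq
    obtain ⟨c, hc, hc0⟩ := exists_deriv_eq_zero huv
      (fun t ht => (hd t ⟨hu.1.trans ht.1, ht.2.trans hv.2⟩).continuousAt.continuousWithinAt) heq
    exact hne c ⟨hu.1.trans hc.1.le, hc.2.le.trans hv.2⟩ hc0
  intro u hu v hv huv
  rcases lt_trichotomy u v with h1 | h1 | h1
  · exact absurd huv (key u hu v hv h1)
  · exact h1
  · exact absurd huv.symm (key v hv u hu h1)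

section Geometry

variable {n : ℕ} {f : E n → ℝ → E n → ℝ} {B : Set (E n)} {D₁ : Set (E n × ℝ)} {r : ℝ} {L : Set ℝ}
  {φ Λ : E n → ℝ → ℝ} {y₀ : E n → ℝ} {K : Set (E n)} {U : Set (E n × ℝ)}

theorem IsStationaryField.contDiffOn_interior (h : IsStationaryField f B D₁ r L φ Λ) :
    ContDiffOn ℝ 1 (fun p : E n × ℝ => φ p.1 p.2) (interior B ×ˢ Ioo (-r) r) :=
  h.contDiffOn.mono (prod_mono interior_subset le_rfl)

/-- Points over which an open subset of the covered region lies are interior to the base. -/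
theorem IsStationaryField.mem_interior (h : IsStationaryField f B D₁ r L φ Λ) (hU : IsOpen U)
    (hUD : U ⊆ D₁) {x : E n} {y : ℝ} (hx : (x, y) ∈ U) : x ∈ interior B := by
  rw [mem_interior_iff_mem_nhds]
  have hc : ContinuousAt (fun x' : E n => (x', y)) x := by fun_prop
  filter_upwards [hc.preimage_mem_nhds (hU.mem_nhds hx)] with x' hx'
  exact h.base_mem x' y (hUD hx')

/-- The parameter of the member of the family that passes through the points of the graph of `y₀`
is the same along the whole graph, since it is a locally constant function: two members with
nearby parameters differ at every point where the family is regular. -/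
theorem IsStationaryField.exists_param (h : IsStationaryField f B D₁ r L φ Λ)
    (hy₀c : ContinuousOn y₀ B) (hy₀ : ∃ s ∈ L, EqOn y₀ (fun x => φ x s) B) (hU : IsOpen U)
    (hUD : U ⊆ D₁) (hK : IsPreconnected K) (hKU : ∀ x ∈ K, (x, y₀ x) ∈ U) :
    ∃ s₀, ∀ x ∈ K, Λ x (y₀ x) = s₀ := by
  have hKO : ∀ x ∈ K, x ∈ interior B := fun x hx => h.mem_interior hU hUD (hKU x hx)
  obtain ⟨s, hs, hys⟩ := hy₀
  have hmember : ∀ x ∈ K, EqOn y₀ (fun t => φ t (Λ x (y₀ x))) B := fun x hx =>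
    hys.trans (h.unique x (y₀ x) (hUD (hKU x hx)) s hs (hys (interior_subset (hKO x hx))).symm)
  set l : K → ℝ := fun x => Λ x (y₀ x) with hl
  have hlc : Continuous l := by
    have h1 : ContinuousOn (fun x => Λ x (y₀ x)) K :=
      h.param_continuousOn.comp
        (continuousOn_id.prodMk (hy₀c.mono fun x hx => interior_subset (hKO x hx)))
        fun x hx => hUD (hKU x hx)
    exact h1.domRestrict
  have hloc : IsLocallyConstant l := by
    rw [IsLocallyConstant.iff_eventually_eq]
    intro x
    have hxU := hKU x x.2
    have hL := h.param_subset (h.param_mem _ _ (hUD hxU))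
    have hd := (hasDerivAt_family isOpen_interior isOpen_Ioo h.contDiffOn_interior
      (hKO x x.2) hL).1
    have hne := hd.eventually_ne (c := φ x (l x)) (h.deriv_ne_zero _ _ (hUD hxU))
    rw [eventually_nhdsWithin_iff] at hne
    filter_upwards [hlc.continuousAt.eventually hne] with x' hx'
    by_contra hcon
    refine hx' hcon ?_
    have e1 := hmember x' x'.2 (interior_subset (hKO x x.2))
    have e2 := hmember x x.2 (interior_subset (hKO x x.2))
    simp only at e1 e2
    rw [← e1, ← e2]
  have : PreconnectedSpace K := Subtype.preconnectedSpace hK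
  rcases K.eq_empty_or_nonempty with rfl | ⟨x₀, hx₀⟩
  · exact ⟨0, fun x hx => hx.elim⟩
  · exact ⟨l ⟨x₀, hx₀⟩, fun x hx => hloc.apply_eq_of_preconnectedSpace ⟨x, hx⟩ ⟨x₀, hx₀⟩⟩

/-- All parameters close to that of `y₀` occur in the family, and the family is regular there. -/
theorem IsStationaryField.exists_tube (h : IsStationaryField f B D₁ r L φ Λ)
    (hU : IsOpen U) (hUD : U ⊆ D₁) (hK : IsCompact K) (hKne : K.Nonempty)
    (hKU : ∀ x ∈ K, (x, y₀ x) ∈ U) {s₀ : ℝ} (hs₀ : ∀ x ∈ K, Λ x (y₀ x) = s₀) :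
    ∃ e > 0, Icc (s₀ - e) (s₀ + e) ⊆ L ∧
      ∀ x ∈ K, ∀ s ∈ Icc (s₀ - e) (s₀ + e), deriv (φ x) s ≠ 0 := by
  set O := interior B with hO
  have hKO : ∀ x ∈ K, x ∈ O := fun x hx => h.mem_interior hU hUD (hKU x hx)
  obtain ⟨x₁, hx₁⟩ := hKne
  have hs₀L : s₀ ∈ L := hs₀ x₁ hx₁ ▸ h.param_mem _ _ (hUD (hKU x₁ hx₁))
  have hs₀T := h.param_subset hs₀L
  have hφ := h.contDiffOn_interior
  have hVo : IsOpen ((O ×ˢ Ioo (-r) r) ∩ (fun p : E n × ℝ => deriv (φ p.1) p.2) ⁻¹' {0}ᶜ) :=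
    (continuousOn_deriv_family isOpen_interior isOpen_Ioo hφ).isOpen_inter_preimage
      (isOpen_interior.prod isOpen_Ioo) isOpen_compl_singleton
  obtain ⟨u, v, -, hvo, hKu, hsv, huv⟩ := generalized_tube_lemma hK
    (isCompact_singleton (x := s₀)) hVo (by
      rintro ⟨x, s⟩ ⟨hx, hs⟩
      rw [mem_singleton_iff] at hs
      simp only at hx hs
      subst hs
      exact ⟨⟨hKO x hx, hs₀T⟩, hs₀ x hx ▸ h.deriv_ne_zero _ _ (hUD (hKU x hx))⟩)
  obtain ⟨e₁, he₁, hball⟩ := Metric.isOpen_iff.mp hvo s₀ (hsv rfl)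
  -- near `s₀`, the member with parameter `s` is the one that passes through `(x₁, φ(x₁, s))`
  have hφx₁ : ContinuousAt (φ x₁) s₀ :=
    (hasDerivAt_family isOpen_interior isOpen_Ioo hφ (hKO x₁ hx₁) hs₀T).1.continuousAt
  have hval : φ x₁ s₀ = y₀ x₁ := by
    rw [← hs₀ x₁ hx₁]; exact h.passes _ _ (hUD (hKU x₁ hx₁))
  have hpt : (x₁, φ x₁ s₀) ∈ U := by rw [hval]; exact hKU x₁ hx₁
  have hc1 : ContinuousAt (fun s => (x₁, φ x₁ s)) s₀ := continuousAt_const.prodMk hφx₁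
  have hc2 : ContinuousAt (fun s => Λ x₁ (φ x₁ s)) s₀ :=
    ContinuousAt.comp (g := fun p : E n × ℝ => Λ p.1 p.2) (f := fun s => (x₁, φ x₁ s))
      (h.param_continuousOn.continuousAt (Filter.mem_of_superset (hU.mem_nhds hpt) hUD)) hc1
  have hm₀ : Λ x₁ (φ x₁ s₀) = s₀ := by rw [hval, hs₀ x₁ hx₁]
  have hhalf : 0 < e₁ / 2 := half_pos he₁
  have hIcc : Icc (s₀ - e₁ / 2) (s₀ + e₁ / 2) ⊆ v := fun s hs => hball (by
    rw [Metric.mem_ball, Real.dist_eq, abs_lt]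
    constructor <;> linarith [hs.1, hs.2])
  have hinj : InjOn (φ x₁) (Icc (s₀ - e₁ / 2) (s₀ + e₁ / 2)) := by
    refine injOn_of_deriv_ne_zero (fun s hs => ?_) fun s hs => ?_
    · have hmem := huv (mk_mem_prod (hKu hx₁) (hIcc hs))
      exact (hasDerivAt_family isOpen_interior isOpen_Ioo hφ hmem.1.1 hmem.1.2).1.differentiableAt
    · exact (huv (mk_mem_prod (hKu hx₁) (hIcc hs))).2
  have hnhds : Icc (s₀ - e₁ / 2) (s₀ + e₁ / 2) ∈ nhds s₀ :=
    Icc_mem_nhds (by linarith) (by linarith)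
  have hev : ∀ᶠ s in nhds s₀, s ∈ L := by
    filter_upwards [hc1.preimage_mem_nhds (hU.mem_nhds hpt), hnhds,
      hc2.preimage_mem_nhds (by rw [hm₀]; exact hnhds)] with s h1 h2 h3
    have h4 := h.passes _ _ (hUD h1)
    have h5 : Λ x₁ (φ x₁ s) = s := hinj h3 h2 h4
    rw [← h5]
    exact h.param_mem _ _ (hUD h1)
  obtain ⟨e₂, he₂, hL⟩ := Metric.eventually_nhds_iff.mp hev
  refine ⟨min (e₁ / 2) (e₂ / 2), lt_min hhalf (half_pos he₂), fun s hs => hL ?_,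
    fun x hx s hs => (huv (mk_mem_prod (hKu hx) (hIcc ?_))).2⟩
  · rw [Real.dist_eq, abs_lt]
    have := min_le_right (e₁ / 2) (e₂ / 2)
    constructor <;> linarith [hs.1, hs.2]
  · have := min_le_left (e₁ / 2) (e₂ / 2)
    exact ⟨by linarith [hs.1], by linarith [hs.2]⟩

/-- Functions uniformly close to `y₀` stay in the covered region, and meet only members of the
family with parameters close to that of `y₀`. -/
theorem IsStationaryField.exists_delta (h : IsStationaryField f B D₁ r L φ Λ)
    (hy₀c : ContinuousOn y₀ B) (hU : IsOpen U) (hUD : U ⊆ D₁) (hK : IsCompact K)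
    (hKU : ∀ x ∈ K, (x, y₀ x) ∈ U) {s₀ : ℝ} (hs₀ : ∀ x ∈ K, Λ x (y₀ x) = s₀) {e : ℝ}
    (he : 0 < e) :
    ∃ δ > 0, ∀ x ∈ K, ∀ t, |t - y₀ x| < δ → (x, t) ∈ U ∧ Λ x t ∈ Icc (s₀ - e) (s₀ + e) := by
  have hW : IsOpen (U ∩ (fun p : E n × ℝ => Λ p.1 p.2) ⁻¹' Ioo (s₀ - e) (s₀ + e)) :=
    (h.param_continuousOn.mono hUD).isOpen_inter_preimage hU isOpen_Ioo
  have hgraph : IsCompact ((fun x => (x, y₀ x)) '' K) :=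
    hK.image_of_continuousOn (continuousOn_id.prodMk (hy₀c.mono fun x hx =>
      interior_subset (h.mem_interior hU hUD (hKU x hx))))
  obtain ⟨δ, hδ, hsub⟩ := hgraph.exists_thickening_subset_open hW (by
    rintro _ ⟨x, hx, rfl⟩
    refine ⟨hKU x hx, ?_⟩
    simp only [mem_preimage, hs₀ x hx]
    constructor <;> linarith)
  refine ⟨δ, hδ, fun x hx t ht => ?_⟩
  have := hsub (Metric.mem_thickening_iff.mpr ⟨_, mem_image_of_mem _ hx, by
    show dist (x, t) (x, y₀ x) < δ
    rw [Prod.dist_eq, dist_self, Real.dist_eq, max_eq_right (abs_nonneg _)]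
    exact ht⟩)
  exact ⟨this.1, Ioo_subset_Icc_self this.2⟩

end Geometry

/-- Differentiation of the relation `φ(x, σ(x)) = y(x)`, for a continuous `σ` and a regular
family. -/
theorem hasFDerivAt_param {n : ℕ} {φ : E n → ℝ → ℝ} {O : Set (E n)} {T : Set ℝ} (hO : IsOpen O)
    (hT : IsOpen T) (hφ : ContDiffOn ℝ 1 (fun p : E n × ℝ => φ p.1 p.2) (O ×ˢ T)) {x : E n}
    (hx : x ∈ O) {σ y : E n → ℝ} (hσx : σ x ∈ T) (hσ : ContinuousAt σ x)
    (hne : deriv (φ x) (σ x) ≠ 0) (hy : DifferentiableAt ℝ y x)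
    (heq : ∀ᶠ t in nhds x, φ t (σ t) = y t) :
    HasFDerivAt σ ((deriv (φ x) (σ x))⁻¹ • (fderiv ℝ y x -
      InnerProductSpace.toDual ℝ (E n) (gradient (fun t => φ t (σ x)) x))) x := by
  set Φ' := fderiv ℝ (fun p : E n × ℝ => φ p.1 p.2) (x, σ x) with hΦ'
  have hΦ : HasFDerivAt (fun p : E n × ℝ => φ p.1 p.2) Φ' (x, σ x) :=
    ((hφ.contDiffAt ((hO.prod hT).mem_nhds ⟨hx, hσx⟩)).differentiableAt one_ne_zero).hasFDerivAt
  have h1 : deriv (φ x) (σ x) = Φ' (0, 1) := (hasDerivAt_family hO hT hφ hx hσx).2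
  have h2 : InnerProductSpace.toDual ℝ (E n) (gradient (fun t => φ t (σ x)) x)
      = Φ'.comp (ContinuousLinearMap.inl ℝ (E n) ℝ) := by
    rw [(hasGradientAt_family hO hT hφ hx hσx).2, LinearIsometryEquiv.apply_symm_apply]
  rw [h1] at hne ⊢
  rw [h2]
  let S : E n × ℝ →L[ℝ] E n × ℝ := (ContinuousLinearMap.fst ℝ (E n) ℝ).prod
    ((Φ' (0, 1))⁻¹ • (ContinuousLinearMap.snd ℝ (E n) ℝ -
      (Φ'.comp (ContinuousLinearMap.inl ℝ (E n) ℝ)).comp (ContinuousLinearMap.fst ℝ (E n) ℝ)))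
  have hF : HasFDerivAt (fun p : E n × ℝ => (p.1, φ p.1 p.2))
      ((ContinuousLinearMap.fst ℝ (E n) ℝ).prod Φ') (x, σ x) := hasFDerivAt_fst.prodMk hΦ
  have hH : HasFDerivAt (fun t => (t, y t))
      ((ContinuousLinearMap.id ℝ (E n)).prod (fderiv ℝ y x)) x :=
    (hasFDerivAt_id x).prodMk hy.hasFDerivAt
  have hG := HasFDerivAt.of_comp_of_leftInverse (g := fun t => (t, σ t)) (f'symm := S)
    (continuousAt_id.prodMk hσ) hF hH (heq.mono fun t ht => by simp [ht]) (fun p => by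
      have hsplit : Φ' p = Φ' (p.1, 0) + p.2 * Φ' (0, 1) := by
        rw [← smul_eq_mul, ← map_smul, ← map_add]; simp
      refine Prod.ext (by simp [S]) ?_
      simp [S]
      rw [hsplit]
      field_simp
      ring)
  have := (ContinuousLinearMap.snd ℝ (E n) ℝ).hasFDerivAt.comp x hG
  refine HasFDerivAt.congr_fderiv (f := σ) this ?_
  ext v
  simp [S]

end

noncomputable section

/-! ### The Hilbert integral of the field -/

section Hilbert

variable {n : ℕ} {f : E n → ℝ → E n → ℝ} {B : Set (E n)} {D₁ : Set (E n × ℝ)} {r : ℝ} {L : Set ℝ}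
  {φ Λ : E n → ℝ → ℝ} {Ω : Set (E n)} {y : E n → ℝ}

/-- The integrand of the Hilbert integral. -/
def hilbertIntegrand (f : E n → ℝ → E n → ℝ) (θ : E n → ℝ → E n) (y : E n → ℝ) (x : E n) : ℝ :=
  (f x (y x) (θ x (y x)) - inner ℝ (gradZ f x (y x) (θ x (y x))) (θ x (y x))) +
    inner ℝ (gradZ f x (y x) (θ x (y x))) (gradient y x)

theorem excess_eq_sub_hilbertIntegrand (θ : E n → ℝ → E n) (x : E n) :
    excess f x (y x) (θ x (y x)) (gradient y x)
      = f x (y x) (gradient y x) - hilbertIntegrand f θ y x := by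
  rw [excess, hilbertIntegrand, inner_sub_right]; ring

theorem slopeField_eq_gradient {x : E n} (hx : x ∈ interior B) (t : ℝ) :
    slopeField B φ Λ x t = gradient (fun u => φ u (Λ x t)) x := by
  rw [slopeField, gradientWithin, gradient,
    fderivWithin_of_mem_nhds (mem_interior_iff_mem_nhds.mp hx)]

/-- The energy density and the Hilbert integrand are integrable: on `Ω` they agree with functions
continuous on the closure, which is compact. -/
theorem IsStationaryField.integrableOn (h : IsStationaryField f B D₁ r L φ Λ)
    (hf : ContDiffOn ℝ 1 (fun p : E n × ℝ × E n => f p.1 p.2.1 p.2.2) (interior B ×ˢ univ))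
    (hΩ : IsOpen Ω) (hb : Bornology.IsBounded Ω) (hΩB : closure Ω ⊆ interior B)
    (hy : IsC1Closure Ω y) (hyD : ∀ x ∈ closure Ω, (x, y x) ∈ D₁) :
    IntegrableOn (fun x => f x (y x) (gradient y x)) Ω ∧
      IntegrableOn (hilbertIntegrand f (slopeField B φ Λ) y) Ω := by
  obtain ⟨-, hyc, G, hG, hGy⟩ := hy
  have hσ : ContinuousOn (fun x => Λ x (y x)) (closure Ω) :=
    h.param_continuousOn.comp (continuousOn_id.prodMk hyc) fun x hx => hyD x hx
  have hθ : ContinuousOn (fun x => slopeField B φ Λ x (y x)) (closure Ω) :=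
    ((continuousOn_gradient_family isOpen_interior isOpen_Ioo h.contDiffOn_interior).comp
      (continuousOn_id.prodMk hσ) fun x hx =>
        ⟨hΩB hx, h.param_subset (h.param_mem _ _ (hyD x hx))⟩).congr
      fun x hx => slopeField_eq_gradient (hΩB hx) _
  have hjet : ∀ {w : E n → E n}, ContinuousOn w (closure Ω) →
      ContinuousOn (fun x => (x, y x, w x)) (closure Ω) := fun hw =>
    continuousOn_id.prodMk (hyc.prodMk hw)
  have hf' : ∀ {w : E n → E n}, ContinuousOn w (closure Ω) →
      ContinuousOn (fun x => f x (y x) (w x)) (closure Ω) := fun hw =>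
    hf.continuousOn.comp (hjet hw) fun x hx => ⟨hΩB hx, mem_univ _⟩
  have hP : ContinuousOn (fun x => gradZ f x (y x) (slopeField B φ Λ x (y x))) (closure Ω) :=
    (continuousOn_gradZ isOpen_interior hf).comp (hjet hθ) fun x hx => ⟨hΩB hx, mem_univ _⟩
  have key : ∀ {w w' : E n → ℝ}, ContinuousOn w (closure Ω) → EqOn w w' Ω → IntegrableOn w' Ω :=
    fun hw hww => ((hw.integrableOn_compact hb.isCompact_closure).mono_set
      subset_closure).congr_fun hww hΩ.measurableSet
  refine ⟨key (hf' hG) fun x hx => by simp only [hGy x hx],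
    key (((hf' hθ).sub (hP.inner hθ)).add (hP.inner hG)) fun x hx => by
      simp only [hilbertIntegrand, ← hGy x hx, Pi.add_apply, Pi.sub_apply]⟩

/-- Invariance of the Hilbert integral. Written in the parameter `σ(x) = Λ(x, y(x))`, its
integrand is `f(x, φ, ∇φ) + φ_s f_z(x, φ, ∇φ) · ∇σ` at `s = σ(x)`, and so differs from the density
of the member `s₀` by the flux of the conservation law of the family. -/
theorem IsStationaryField.hilbertIntegral_eq (hn : 0 < n) (h : IsStationaryField f B D₁ r L φ Λ)
    (hf : ContDiffOn ℝ 1 (fun p : E n × ℝ × E n => f p.1 p.2.1 p.2.2) (interior B ×ˢ univ))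
    (hΩ : IsOpen Ω) (hb : Bornology.IsBounded Ω) (hΩB : closure Ω ⊆ interior B)
    (hconv : ∀ x ∈ Ω, ∀ y : ℝ, ConvexOn ℝ univ (f x y)) {s₀ e : ℝ} (he : 0 < e)
    (hJL : Icc (s₀ - e) (s₀ + e) ⊆ L)
    (hne : ∀ x ∈ closure Ω, ∀ s ∈ Icc (s₀ - e) (s₀ + e), deriv (φ x) s ≠ 0)
    (hy : IsC1Closure Ω y) (hyD : ∀ x ∈ closure Ω, (x, y x) ∈ D₁)
    (hyJ : ∀ x ∈ closure Ω, Λ x (y x) ∈ Icc (s₀ - e) (s₀ + e))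
    (hyf : ∀ x ∈ frontier Ω, Λ x (y x) = s₀) :
    hilbertIntegral f (slopeField B φ Λ) Ω y = ∫ x in Ω, density f φ x s₀ := by
  have hint := (h.integrableOn hf hΩ hb hΩB hy hyD).2
  obtain ⟨hy1, hyc, G, hG, hGy⟩ := hy
  have hO : IsOpen (interior B) := isOpen_interior
  have hT : IsOpen (Ioo (-r) r) := isOpen_Ioo
  have hφ := h.contDiffOn_interior
  have hJT : Icc (s₀ - e) (s₀ + e) ⊆ Ioo (-r) r := hJL.trans h.param_subset
  have hs₀ : s₀ ∈ Icc (s₀ - e) (s₀ + e) := ⟨by linarith, by linarith⟩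
  have hKJ : closure Ω ×ˢ Icc (s₀ - e) (s₀ + e) ⊆ interior B ×ˢ Ioo (-r) r := prod_mono hΩB hJT
  have hΩB' : Ω ⊆ interior B := subset_closure.trans hΩB
  set σ : E n → ℝ := fun x => Λ x (y x) with hσdef
  have hσ : ContinuousOn σ (closure Ω) :=
    h.param_continuousOn.comp (continuousOn_id.prodMk hyc) fun x hx => hyD x hx
  have hpass : ∀ x ∈ closure Ω, φ x (σ x) = y x := fun x hx => h.passes _ _ (hyD x hx)
  have hσm : MapsTo (fun x => (x, σ x)) (closure Ω) (interior B ×ˢ Ioo (-r) r) :=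
    fun x hx => ⟨hΩB hx, hJT (hyJ x hx)⟩
  have hyd : ∀ x ∈ Ω, HasGradientAt y (gradient y x) x := fun x hx =>
    ((hy1.contDiffAt (hΩ.mem_nhds hx)).differentiableAt one_ne_zero).hasGradientAt
  have hdσ : ∀ x ∈ Ω, HasFDerivAt σ ((deriv (φ x) (σ x))⁻¹ • (fderiv ℝ y x -
      InnerProductSpace.toDual ℝ (E n) (gradient (fun t => φ t (σ x)) x))) x := fun x hx =>
    hasFDerivAt_param hO hT hφ (hΩB' hx) (hJT (hyJ x (subset_closure hx)))
      (hσ.continuousAt (Filter.mem_of_superset (hΩ.mem_nhds hx) subset_closure))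
      (hne x (subset_closure hx) _ (hyJ x (subset_closure hx))) (hyd x hx).differentiableAt
      (by filter_upwards [hΩ.mem_nhds hx] with t ht using hpass t (subset_closure ht))
  -- the derivative of `σ` extends continuously to the closure, hence is bounded
  let R : E n → E n →L[ℝ] ℝ := fun x => (deriv (φ x) (σ x))⁻¹ •
    (InnerProductSpace.toDual ℝ (E n) (G x) -
      InnerProductSpace.toDual ℝ (E n) (gradient (fun t => φ t (σ x)) x))
  have hR : ContinuousOn R (closure Ω) := by
    refine ContinuousOn.smul (ContinuousOn.inv₀ ?_ fun x hx => hne x hx _ (hyJ x hx))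
      (ContinuousOn.sub ?_ ?_)
    · exact (continuousOn_deriv_family hO hT hφ).comp (continuousOn_id.prodMk hσ) hσm
    · exact (InnerProductSpace.toDual ℝ (E n)).continuous.comp_continuousOn hG
    · exact (InnerProductSpace.toDual ℝ (E n)).continuous.comp_continuousOn
        ((continuousOn_gradient_family hO hT hφ).comp (continuousOn_id.prodMk hσ) hσm)
  have hσR : ∀ x ∈ Ω, fderiv ℝ σ x = R x := fun x hx => by
    rw [(hdσ x hx).fderiv]
    simp only [R]
    rw [hGy x hx, toDual_gradient, toDual_gradient]
  obtain ⟨M, hM⟩ := hb.isCompact_closure.exists_bound_of_continuousOn hR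
  have hσ1 : ContDiffOn ℝ 1 σ Ω := by
    rw [show (1 : WithTop ℕ∞) = 0 + 1 from rfl, contDiffOn_succ_iff_fderiv_of_isOpen hΩ]
    refine ⟨fun x hx => (hdσ x hx).differentiableAt.differentiableWithinAt, by simp, ?_⟩
    rw [contDiffOn_zero]
    exact (hR.mono subset_closure).congr hσR
  have hweak := isWeakConservationLaw_of_stationary hn hO hT hb hΩB hJT hf hφ hconv
    (fun s hs => ((h.stationary s (hJL hs)).momentum_interior).1)
    (fun s hs => ((h.stationary s (hJL hs)).momentum_interior).2)
  have hflux := integral_graph_sub_level_eq_zero hΩ hb he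
    ((continuousOn_density hO hT hf hφ).mono hKJ)
    (((continuousOn_deriv_family hO hT hφ).smul (continuousOn_momentum hO hT hf hφ)).mono hKJ)
    hweak hσ hσ1 (fun x hx => by rw [hσR x hx]; exact hM x (subset_closure hx)) hyf
    (fun x hx => hyJ x (subset_closure hx))
  have hdens : IntegrableOn (fun x => density f φ x s₀) Ω :=
    (((continuousOn_density hO hT hf hφ).comp (f := fun x : E n => (x, s₀)) (by fun_prop)
      fun x hx => hKJ ⟨hx, hs₀⟩).integrableOn_compact hb.isCompact_closure).mono_set subset_closure
  have hpt : ∀ x ∈ Ω, hilbertIntegrand f (slopeField B φ Λ) y x - density f φ x s₀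
      = density f φ x (σ x) - density f φ x s₀
        + fderiv ℝ σ x (deriv (φ x) (σ x) • momentum f φ x (σ x)) := by
    intro x hx
    have hc : deriv (φ x) (σ x) ≠ 0 := hne x (subset_closure hx) _ (hyJ x (subset_closure hx))
    have hθ : slopeField B φ Λ x (y x) = gradient (fun t => φ t (σ x)) x :=
      slopeField_eq_gradient (hΩB' hx) _
    rw [hilbertIntegrand, hθ, ← hpass x (subset_closure hx)]
    change f x _ _ - inner ℝ (momentum f φ x (σ x)) _ + inner ℝ (momentum f φ x (σ x)) _ - _
      = f x _ _ - _ + _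
    rw [(hdσ x hx).fderiv, smul_apply, sub_apply, InnerProductSpace.toDual_apply_apply, map_smul,
      inner_smul_right, ← toDual_gradient, InnerProductSpace.toDual_apply_apply,
      real_inner_comm, real_inner_comm (gradient y x)]
    simp only [smul_eq_mul]
    field_simp
    ring
  have : hilbertIntegral f (slopeField B φ Λ) Ω y - ∫ x in Ω, density f φ x s₀ = 0 := by
    rw [← hflux]
    change (∫ x in Ω, hilbertIntegrand f (slopeField B φ Λ) y x) - _ = _
    rw [← integral_sub hint hdens]
    exact setIntegral_congr_fun hΩ.measurableSet hpt
  linarith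

end Hilbert

end

theorem theorem1 {n : ℕ} (hn : 0 < n)
    -- the domain and the box
    (Ω : Set (E n)) (hΩ_open : IsOpen Ω) (hΩ_bdd : Bornology.IsBounded Ω)
    (hΩ_sc : IsSimplyConnected Ω) (hΩ_lip : HasLipschitzBoundary Ω)
    (a b : Fin n → ℝ) (hΩ_box : ∀ x ∈ Ω, ∀ k, a k < x k ∧ x k < b k)
    -- the integrand
    (f : E n → ℝ → E n → ℝ)
    (hf : ContDiffOn ℝ 1 (fun p : E n × ℝ × E n => f p.1 p.2.1 p.2.2) (box a b ×ˢ univ))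
    (hf_conv : ∀ x ∈ closure Ω, ∀ y : ℝ, ConvexOn ℝ univ (f x y))
    -- the stationary function
    (y₀ : E n → ℝ) (hy₀ : IsStationaryFor f (box a b) y₀)
    -- the field of stationary functions; the function `y₀` belongs to it
    (D₁ : Set (E n × ℝ)) (r : ℝ) (L : Set ℝ) (φ Λ : E n → ℝ → ℝ)
    (hfield : IsStationaryField f (box a b) D₁ r L φ Λ)
    (hy₀_mem : ∃ s ∈ L, EqOn y₀ (fun x => φ x s) (box a b))
    (hcover : ∃ U : Set (E n × ℝ), IsOpen U ∧ U ⊆ D₁ ∧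
      closure ((fun x => (x, y₀ x)) '' Ω) ⊆ U) :
    ∃ δ : ℝ, 0 < δ ∧ ∀ y : E n → ℝ, IsC1Closure Ω y → (∀ x ∈ frontier Ω, y x = y₀ x) →
      (∀ x ∈ closure Ω, |y x - y₀ x| < δ) →
        (∀ x ∈ closure Ω, (x, y x) ∈ D₁) ∧
        hilbertIntegral f (slopeField (box a b) φ Λ) Ω y =
          hilbertIntegral f (slopeField (box a b) φ Λ) Ω y₀ ∧
        energy f Ω y - energy f Ω y₀ =
          ∫ x in Ω, excess f x (y x) (slopeField (box a b) φ Λ x (y x)) (gradient y x) ∧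
        energy f Ω y₀ ≤ energy f Ω y := by
  obtain ⟨U, hU, hUD, hUcl⟩ := hcover
  have hy₀c : ContinuousOn y₀ (box a b) := hy₀.1.continuousOn
  have hclB : closure Ω ⊆ box a b :=
    closure_minimal (fun x hx k => ⟨(hΩ_box x hx k).1.le, (hΩ_box x hx k).2.le⟩) (isClosed_box a b)
  have hgraph : ∀ x ∈ closure Ω, (x, y₀ x) ∈ U := fun x hx => hUcl
    (((continuousOn_id.prodMk hy₀c x (hclB hx)).mono
      (subset_closure.trans hclB)).mem_closure_image hx)
  have hΩB : closure Ω ⊆ interior (box a b) := fun x hx => hfield.mem_interior hU hUD (hgraph x hx)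
  have hΩB' : Ω ⊆ interior (box a b) := subset_closure.trans hΩB
  have hK : IsCompact (closure Ω) := hΩ_bdd.isCompact_closure
  have hconn : IsConnected Ω := hΩ_sc.isPathConnected.isConnected
  have hf' := hf.mono (prod_mono (interior_subset (s := box a b)) (le_refl (univ : Set (ℝ × E n))))
  obtain ⟨s₀, hs₀⟩ := hfield.exists_param hy₀c hy₀_mem hU hUD hconn.closure.isPreconnected hgraph
  obtain ⟨e, he, hJL, hne⟩ := hfield.exists_tube hU hUD hK hconn.closure.nonempty hgraph hs₀
  obtain ⟨δ, hδ, hclose⟩ := hfield.exists_delta hy₀c hU hUD hK hgraph hs₀ he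
  have hconv : ∀ x ∈ Ω, ∀ y : ℝ, ConvexOn ℝ univ (f x y) := fun x hx =>
    hf_conv x (subset_closure hx)
  have hI := fun y hy hyD hyJ hyf => hfield.hilbertIntegral_eq (y := y) hn hf' hΩ_open hΩ_bdd hΩB
    hconv he hJL hne hy hyD hyJ hyf
  -- `y₀` is itself an admissible comparison function, and its slope is that of the field
  have hy₀1 : ContDiffOn ℝ 1 y₀ (interior (box a b)) := hy₀.1.mono interior_subset
  have hy₀C : IsC1Closure Ω y₀ := by
    refine ⟨hy₀1.mono hΩB', hy₀c.mono hclB, gradient y₀, ?_, fun _ _ => rfl⟩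
    exact (InnerProductSpace.toDual ℝ (E n)).symm.continuous.comp_continuousOn
      ((hy₀1.continuousOn_fderiv_of_isOpen isOpen_interior le_rfl).mono hΩB)
  have hy₀D : ∀ x ∈ closure Ω, (x, y₀ x) ∈ D₁ := fun x hx => hUD (hgraph x hx)
  have hI₀ := hI y₀ hy₀C hy₀D (fun x hx => by
    rw [hs₀ x hx]; constructor <;> linarith) fun x hx => hs₀ x (frontier_subset_closure hx)
  have hE₀ : energy f Ω y₀ = hilbertIntegral f (slopeField (box a b) φ Λ) Ω y₀ := by
    refine setIntegral_congr_fun hΩ_open.measurableSet fun x hx => ?_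
    have hslope : slopeField (box a b) φ Λ x (y₀ x) = gradient y₀ x := by
      obtain ⟨s, hs, hys⟩ := hy₀_mem
      have hx' := subset_closure hx
      rw [slopeField_eq_gradient (hΩB' hx)]
      have hEq := hys.trans (hfield.unique x (y₀ x) (hy₀D x hx') s hs (hys (hclB hx')).symm)
      have hev := (hEq.mono interior_subset).eventuallyEq_of_mem
        (isOpen_interior.mem_nhds (hΩB' hx))
      exact hev.gradient_eq.symm
    simp only [hslope]
    ring
  refine ⟨δ, hδ, fun y hy hyf hyδ => ?_⟩
  have hyD : ∀ x ∈ closure Ω, (x, y x) ∈ D₁ := fun x hx => hUD (hclose x hx _ (hyδ x hx)).1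
  have hIy := hI y hy hyD (fun x hx => (hclose x hx _ (hyδ x hx)).2) fun x hx => by
    rw [hyf x hx]; exact hs₀ x (frontier_subset_closure hx)
  obtain ⟨hint1, hint2⟩ := hfield.integrableOn hf' hΩ_open hΩ_bdd hΩB hy hyD
  have hdiff : energy f Ω y - energy f Ω y₀ =
      ∫ x in Ω, excess f x (y x) (slopeField (box a b) φ Λ x (y x)) (gradient y x) := by
    simp only [excess_eq_sub_hilbertIntegrand]
    rw [integral_sub hint1 hint2, hE₀, hI₀, ← hIy]
    rfl
  refine ⟨hyD, hIy.trans hI₀.symm, hdiff, ?_⟩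
  rw [← sub_nonneg, hdiff]
  refine setIntegral_nonneg hΩ_open.measurableSet fun x hx => ?_
  rw [excess, sub_nonneg]
  exact inner_gradZ_le_sub isOpen_interior hf' (hΩB' hx) (hconv x hx _) _ _
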